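/- Let $\mathbb{K}$ be a field of characteristic zero and let $V$ be a $\mathbb{K}$-vector space of finite dimension $n$. A ternary partially associative algebra (an algebra of type $\bullet_{3,3}$) is a $\mathbb{K}$-vector space $A$ with a trilinear product $\mu : A^{\otimes 3}\to A$ such that $$\mu(\mu(a,b,c),d,e)+\mu(a,\mu(b,c,d),e)+\mu(a,b,\mu(c,d,e))=0\qquad (a,b,c,d,e\in A).$$ Let $L(V,\bullet_{3,3})$ be the free ternary partially associative algebra on $V$, and for $p\ge 0$ let $L^{2p+1}(V)\subseteq L(V,\bullet_{3,3})$ be its homogeneous component of degree $2p+1$, i.e. the span of all (iterated) products of $2p+1$ elements of $V$. Then $$\dim L^1(V)=n,\qquad \dim L^3(V)=n^3,\qquad \dim L^5(V)=2n^5,$$ and for every $p\ge 3$ $$\dim L^{2p+1}(V)=(p+1)\,n^{2p+1}.$$ Likewise, let $\mathcal{P}$ be the nonsymmetric operad over $\mathbb{K}$ generated by one ternary operation $\mu$ subject to the single relation $\mu\circ_1\mu+\mu\circ_2\mu+\mu\circ_3\mu=0$. Then $$\dim\mathcal{P}(1)=1,\qquad \dim\mathcal{P}(3)=1,\qquad \dim\mathcal{P}(5)=2,\qquad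 \dim\mathcal{P}(2p+1)=p+1\quad\text{for all } p\ge 3.$$ -/

import Mathlib

noncomputable section

universe u v w

/-! ### Ternary algebras of type `•_{3,3}` (ternary partially associative algebras) -/

section TernaryAlgebra

variable {K : Type u} [Field K] {A : Type w} [AddCommGroup A] [Module K A]

/-- A ternary product, given as a trilinear map, is partially associative (of type `•_{3,3}`)
when `μ(μ(a,b,c),d,e) + μ(a,μ(b,c,d),e) + μ(a,b,μ(c,d,e)) = 0` for all elements. (The signs
`(-1)^{(i-1)(n-1)}` of the `n`-ary definition are all `+1` for `n = 3`.) -/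
def IsPartiallyAssociative (μ : A →ₗ[K] A →ₗ[K] A →ₗ[K] A) : Prop :=
  ∀ a b c d e : A, μ (μ a b c) d e + μ a (μ b c d) e + μ a b (μ c d e) = 0

/-- A two-sided (three-sided) ideal of a ternary algebra: a subspace that absorbs the product in
each of the three arguments. -/
def IsTernaryIdeal (μ : A →ₗ[K] A →ₗ[K] A →ₗ[K] A) (I : Submodule K A) : Prop :=
  ∀ x ∈ I, ∀ a b : A, μ x a b ∈ I ∧ μ a x b ∈ I ∧ μ a b x ∈ I

/-- Cyclic permutation of the arguments of a trilinear map. -/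
def rotate {A B C D : Type*} [AddCommGroup A] [Module K A] [AddCommGroup B] [Module K B]
    [AddCommGroup C] [Module K C] [AddCommGroup D] [Module K D]
    (f : A →ₗ[K] B →ₗ[K] C →ₗ[K] D) : B →ₗ[K] C →ₗ[K] A →ₗ[K] D :=
  (LinearMap.lflip (R₀ := K)).toLinearMap ∘ₗ f.flip

/-- Descent of a trilinear map to a quotient in its first argument. -/
def descend {B C D : Type*} [AddCommGroup B] [Module K B] [AddCommGroup C] [Module K C]
    [AddCommGroup D] [Module K D] (I : Submodule K A) (f : A →ₗ[K] B →ₗ[K] C →ₗ[K] D)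
    (h : ∀ x ∈ I, ∀ b c, f x b c = 0) : A ⧸ I →ₗ[K] B →ₗ[K] C →ₗ[K] D :=
  I.liftQ f fun x hx => LinearMap.mem_ker.2 (LinearMap.ext₂ (h x hx))

/-- The product induced by `μ` on the quotient by an ideal. -/
def quotientProduct (μ : A →ₗ[K] A →ₗ[K] A →ₗ[K] A) (I : Submodule K A)
    (hI : IsTernaryIdeal μ I) : A ⧸ I →ₗ[K] A ⧸ I →ₗ[K] A ⧸ I →ₗ[K] A ⧸ I :=
  let f₀ : A →ₗ[K] A →ₗ[K] A →ₗ[K] A ⧸ I :=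
    LinearMap.llcomp K A (A →ₗ[K] A) (A →ₗ[K] A ⧸ I) (LinearMap.llcomp K A A (A ⧸ I) I.mkQ) ∘ₗ μ
  let f₁ : A ⧸ I →ₗ[K] A →ₗ[K] A →ₗ[K] A ⧸ I :=
    descend I f₀ fun x hx a b => (Submodule.Quotient.mk_eq_zero I).2 (hI x hx a b).1
  let f₂ : A ⧸ I →ₗ[K] A →ₗ[K] A ⧸ I →ₗ[K] A ⧸ I :=
    descend I (rotate f₁) fun x hx b a => by
      obtain ⟨a, rfl⟩ := I.mkQ_surjective a
      exact (Submodule.Quotient.mk_eq_zero I).2 (hI x hx a b).2.1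
  let f₃ : A ⧸ I →ₗ[K] A ⧸ I →ₗ[K] A ⧸ I →ₗ[K] A ⧸ I :=
    descend I (rotate f₂) fun x hx a b => by
      obtain ⟨a, rfl⟩ := I.mkQ_surjective a
      obtain ⟨b, rfl⟩ := I.mkQ_surjective b
      exact (Submodule.Quotient.mk_eq_zero I).2 (hI x hx a b).2.2
  rotate f₃

theorem quotientProduct_mk (μ : A →ₗ[K] A →ₗ[K] A →ₗ[K] A) (I : Submodule K A)
    (hI : IsTernaryIdeal μ I) (a b c : A) :
    quotientProduct μ I hI (I.mkQ a) (I.mkQ b) (I.mkQ c) = I.mkQ (μ a b c) := rfl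

end TernaryAlgebra

/-! ### Ternary monomials, i.e. planar ternary trees with labelled leaves -/

/-- Nonassociative ternary monomials in the letters `X`: planar trees all of whose internal nodes
have exactly three ordered inputs, with leaves labelled by `X`. -/
inductive TernaryMonomial (X : Type u) : Type u
  | of : X → TernaryMonomial X
  | mul : TernaryMonomial X → TernaryMonomial X → TernaryMonomial X → TernaryMonomial X

namespace TernaryMonomial

/-- The degree of a monomial: the number of leaves of the tree. -/
def degree {X : Type u} : TernaryMonomial X → ℕ
  | of _ => 1
  | mul r s t => degree r + degree s + degree t

end TernaryMonomial

/-- The vector space of formal linear combinations of ternary monomials in the letters `X`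
(the free ternary algebra, without any identity, on the set `X`). -/
abbrev TernaryPolynomial (K : Type u) [Field K] (X : Type v) : Type (max u v) :=
  TernaryMonomial X →₀ K

namespace TernaryPolynomial

variable (K : Type u) [Field K] {X : Type v}

/-- A monomial as a polynomial. -/
def monomial (t : TernaryMonomial X) : TernaryPolynomial K X := Finsupp.single t 1

/-- The trilinear extension of the formal product of monomials. -/
def mul : TernaryPolynomial K X →ₗ[K] TernaryPolynomial K X →ₗ[K] TernaryPolynomial K X →ₗ[K]
    TernaryPolynomial K X :=
  Finsupp.linearCombination K fun r =>
    Finsupp.linearCombination K fun s =>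
      Finsupp.linearCombination K fun t => monomial K (TernaryMonomial.mul r s t)

variable (X) in
/-- The span of the monomials of degree `m`. -/
def homogeneous (m : ℕ) : Submodule K (TernaryPolynomial K X) :=
  Submodule.span K (monomial K '' {t | t.degree = m})

end TernaryPolynomial

/-! ### The free ternary partially associative algebra on a vector space -/

namespace FreePartiallyAssociative

open TernaryPolynomial

section Construction

variable (K : Type u) [Field K] (V : Type v) [AddCommGroup V] [Module K V]

/-- The defining relators: the letters `v ∈ V` depend linearly on `v`, and the product is
partially associative. -/
inductive Relator : TernaryPolynomial K V → Prop
  | add (v w : V) : Relator (monomial K (.of (v + w)) - monomial K (.of v) - monomial K (.of w))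
  | smul (c : K) (v : V) : Relator (monomial K (.of (c • v)) - c • monomial K (.of v))
  | assoc (a b c d e : TernaryPolynomial K V) :
      Relator (mul K (mul K a b c) d e + mul K a (mul K b c d) e + mul K a b (mul K c d e))

/-- The ideal generated by the relators. -/
def relations : Submodule K (TernaryPolynomial K V) :=
  sInf {I | IsTernaryIdeal (mul K) I ∧ ∀ f, Relator K V f → f ∈ I}

theorem relations_isTernaryIdeal : IsTernaryIdeal (mul K) (relations K V) := by
  intro x hx a b
  simp only [relations, Submodule.mem_sInf] at hx ⊢
  exact ⟨fun I hI => (hI.1 x (hx I hI) a b).1, fun I hI => (hI.1 x (hx I hI) a b).2.1,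
    fun I hI => (hI.1 x (hx I hI) a b).2.2⟩

theorem mem_relations {f : TernaryPolynomial K V} (hf : Relator K V f) : f ∈ relations K V := by
  simp only [relations, Submodule.mem_sInf]
  exact fun I hI => hI.2 f hf

end Construction

end FreePartiallyAssociative

/-- The free ternary partially associative algebra `L(V, •_{3,3})` on the vector space `V`. -/
abbrev FreePartiallyAssociative (K : Type u) [Field K] (V : Type v) [AddCommGroup V]
    [Module K V] : Type (max u v) :=
  TernaryPolynomial K V ⧸ FreePartiallyAssociative.relations K V

namespace FreePartiallyAssociative

open TernaryPolynomial

section Product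

variable (K : Type u) [Field K] (V : Type v) [AddCommGroup V] [Module K V]

/-- The ternary product of the free algebra, induced on the quotient. -/
def product : FreePartiallyAssociative K V →ₗ[K] FreePartiallyAssociative K V →ₗ[K]
    FreePartiallyAssociative K V →ₗ[K] FreePartiallyAssociative K V :=
  quotientProduct (mul K) (relations K V) (relations_isTernaryIdeal K V)

theorem product_mk (a b c : TernaryPolynomial K V) :
    product K V ((relations K V).mkQ a) ((relations K V).mkQ b) ((relations K V).mkQ c) =
      (relations K V).mkQ (mul K a b c) :=
  quotientProduct_mk _ _ _ a b c

/-- The free algebra is of type `•_{3,3}`. -/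
theorem product_isPartiallyAssociative : IsPartiallyAssociative (product K V) := by
  intro a b c d e
  obtain ⟨a, rfl⟩ := (relations K V).mkQ_surjective a
  obtain ⟨b, rfl⟩ := (relations K V).mkQ_surjective b
  obtain ⟨c, rfl⟩ := (relations K V).mkQ_surjective c
  obtain ⟨d, rfl⟩ := (relations K V).mkQ_surjective d
  obtain ⟨e, rfl⟩ := (relations K V).mkQ_surjective e
  simp only [product_mk, ← map_add]
  exact (Submodule.Quotient.mk_eq_zero _).2 (mem_relations K V (.assoc a b c d e))

/-- The canonical linear map `V → L(V)`. -/
def ι : V →ₗ[K] FreePartiallyAssociative K V where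
  toFun v := (relations K V).mkQ (monomial K (.of v))
  map_add' v w := by
    rw [← map_add, ← sub_eq_zero, ← map_sub, ← sub_sub]
    exact (Submodule.Quotient.mk_eq_zero _).2 (mem_relations K V (.add v w))
  map_smul' c v := by
    rw [RingHom.id_apply, ← map_smul, ← sub_eq_zero, ← map_sub]
    exact (Submodule.Quotient.mk_eq_zero _).2 (mem_relations K V (.smul c v))

/-- The homogeneous component `L^m(V)`: the span in `L(V)` of the classes of all monomials of
degree `m` in the elements of `V`. -/
def component (m : ℕ) : Submodule K (FreePartiallyAssociative K V) :=
  (homogeneous K V m).map (relations K V).mkQ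

end Product

section UniversalProperty

variable {K : Type u} [Field K] {V : Type v} {A : Type w} [AddCommGroup A] [Module K A]

/-- Evaluation of monomials in a ternary algebra. -/
def evalMonomial (ν : A →ₗ[K] A →ₗ[K] A →ₗ[K] A) (f : V → A) : TernaryMonomial V → A
  | .of x => f x
  | .mul r s t => ν (evalMonomial ν f r) (evalMonomial ν f s) (evalMonomial ν f t)

theorem eval_mul (ν : A →ₗ[K] A →ₗ[K] A →ₗ[K] A) (f : V → A) (a b c : TernaryPolynomial K V) :
    Finsupp.linearCombination K (evalMonomial ν f) (mul K a b c) =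
      ν (Finsupp.linearCombination K (evalMonomial ν f) a)
        (Finsupp.linearCombination K (evalMonomial ν f) b)
        (Finsupp.linearCombination K (evalMonomial ν f) c) := by
  induction a using Finsupp.induction_linear with
  | zero => simp
  | add a a' h h' => simp only [map_add, LinearMap.add_apply, h, h']
  | single r x =>
    induction b using Finsupp.induction_linear with
    | zero => simp
    | add b b' h h' => simp only [map_add, LinearMap.add_apply, h, h']
    | single s y =>
      induction c using Finsupp.induction_linear with
      | zero => simp
      | add c c' h h' => simp only [map_add, h, h']
      | single t z =>
        simp only [mul, monomial, evalMonomial, Finsupp.linearCombination_single,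
          LinearMap.smul_apply, map_smul, one_smul]
        module

variable [AddCommGroup V] [Module K V]

/-- The universal property: every linear map from `V` to a ternary partially associative algebra
extends uniquely to a morphism of ternary algebras on `L(V)`. -/
theorem existsUnique_lift (ν : A →ₗ[K] A →ₗ[K] A →ₗ[K] A) (hν : IsPartiallyAssociative ν)
    (f : V →ₗ[K] A) :
    ∃! F : FreePartiallyAssociative K V →ₗ[K] A,
      (∀ x y z, F (product K V x y z) = ν (F x) (F y) (F z)) ∧ ∀ v, F (ι K V v) = f v := by
  have hle : relations K V ≤ LinearMap.ker (Finsupp.linearCombination K (evalMonomial ν f)) := by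
    refine sInf_le ⟨?_, ?_⟩
    · intro x hx a b
      simp only [LinearMap.mem_ker] at hx ⊢
      simp [eval_mul, hx]
    · rintro _ (⟨v, w⟩ | ⟨c, v⟩ | ⟨a, b, c, d, e⟩)
      · simp [monomial, evalMonomial]
      · simp [monomial, evalMonomial]
      · rw [LinearMap.mem_ker]
        simp only [map_add, eval_mul]
        exact hν _ _ _ _ _
  refine ⟨(relations K V).liftQ _ hle, ⟨?_, ?_⟩, ?_⟩
  · intro x y z
    obtain ⟨x, rfl⟩ := (relations K V).mkQ_surjective x
    obtain ⟨y, rfl⟩ := (relations K V).mkQ_surjective y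
    obtain ⟨z, rfl⟩ := (relations K V).mkQ_surjective z
    exact eval_mul ν f x y z
  · intro v
    change Finsupp.linearCombination K (evalMonomial ν f) (monomial K (.of v)) = f v
    simp [monomial, evalMonomial]
  · rintro G ⟨hG, hGι⟩
    refine Submodule.linearMap_qext _ (Finsupp.lhom_ext' fun t => LinearMap.ext_ring ?_)
    change G ((relations K V).mkQ (monomial K t)) =
      Finsupp.linearCombination K (evalMonomial ν f) (monomial K t)
    induction t with
    | of v => exact (hGι v).trans (by simp [monomial, evalMonomial])
    | mul r s t hr hs ht =>
      have h : monomial K (.mul r s t) = mul K (monomial K r) (monomial K s) (monomial K t) := by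
        simp [mul, monomial]
      rw [h, ← product_mk, hG, hr, hs, ht, eval_mul]

end UniversalProperty

end FreePartiallyAssociative

/-! ### The nonsymmetric operad of ternary partially associative algebras -/

/-- Planar ternary trees (with unlabelled leaves); the arity of a tree is its degree. -/
abbrev TernaryTree : Type := TernaryMonomial Unit

namespace TernaryTree

/-- The tree obtained from `t` by grafting the root of `s` on the leaf number `i` of `t`, the
leaves being numbered `0, 1, …, t.degree - 1` from left to right. -/
def graft : TernaryTree → ℕ → TernaryTree → TernaryTree
  | .of _, _, s => s
  | .mul a b c, i, s =>
    if i < a.degree then .mul (graft a i s) b c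
    else if i < a.degree + b.degree then .mul a (graft b (i - a.degree) s) c
    else .mul a b (graft c (i - (a.degree + b.degree)) s)

/-- The tree with one internal node. -/
def corolla : TernaryTree := .mul (.of ()) (.of ()) (.of ())

end TernaryTree

namespace PartiallyAssociativeOperad

open TernaryPolynomial

variable (K : Type u) [Field K]

/-- The partial composition `f ∘ᵢ g` (inputs numbered from `0`) in the free nonsymmetric operad on
one ternary generator: grafting of trees, extended bilinearly. The total space of the operad is
spanned by all trees, its arity `m` component by the trees of degree `m`; composition at an input
that does not exist is zero. -/
def circ (i : ℕ) : TernaryPolynomial K Unit →ₗ[K] TernaryPolynomial K Unit →ₗ[K]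
    TernaryPolynomial K Unit :=
  Finsupp.linearCombination K fun t =>
    Finsupp.linearCombination K fun s =>
      if i < t.degree then monomial K (TernaryTree.graft t i s) else 0

/-- The quadratic relator `μ ∘₀ μ + μ ∘₁ μ + μ ∘₂ μ`. -/
def relator : TernaryPolynomial K Unit :=
  ∑ i ∈ Finset.range 3,
    circ K i (monomial K TernaryTree.corolla) (monomial K TernaryTree.corolla)

/-- The operadic ideal generated by the quadratic relator. -/
def operadicIdeal : Submodule K (TernaryPolynomial K Unit) :=
  sInf {I | relator K ∈ I ∧ ∀ f ∈ I, ∀ g i, circ K i f g ∈ I ∧ circ K i g f ∈ I}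

/-- The arity `m` component of the quotient operad. -/
def component (m : ℕ) : Submodule K (TernaryPolynomial K Unit ⧸ operadicIdeal K) :=
  (homogeneous K Unit m).map (operadicIdeal K).mkQ

end PartiallyAssociativeOperad

end

/-!
The dimensions are found by exhibiting normal forms, the same ones for the operad and for the free
algebra. Write `x` for a generator, `u 0 = x`, `u (i + 1) = μ(x, u i, x)`, `v j = μ(x, x, u j)` and
`s i j = μ(x, u i, v j)`. After removal of the coincidences `v 0 = u 1` and `s 0 0 = v 1`, the
elements with `2 p + 1` factors among these are `1`, `1`, `2` in number for `p = 0, 1, 2`, and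
`p + 1` for `p ≥ 3`.

*Spanning.* In seven letters, partial associativity implies two-term identities
(`IsPartiallyAssociative.right_right` and its companions). They imply that a product of three
products is zero (`IsPartiallyAssociative.three_products`) and that a product with two arguments
that are products is annihilated by everything (`isProduct_isProduct_mem` and its companions). A
computation from these facts gives the multiplication table of the normal forms, and the normal
forms span a subalgebra (`NormalForm.mul_mem_level`).

*Independence.* The multiplication table defines a ternary algebra on a vector space with basis the
normal forms (`Model.product`). It is partially associative, as one checks on the basis, so the
normal forms of its generator are linearly independent (`Model.linearIndependent_eval`).

*The operad.* The quotient of the space of trees by the operadic ideal is a partially associative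
algebra generated by the tree with one leaf, and trees can be evaluated in every partially
associative algebra, at an arbitrary sequence of elements, in a way that kills the operadic ideal
(`PartiallyAssociativeOperad.evalPoly_eq_zero`). Therefore the normal forms with `2 p + 1` leaves
are a basis of the component of arity `2 p + 1`.

*The free algebra.* A reduction of a tree to normal forms in the operad is valid for every choice of
letters at the leaves, because the relations do not permute the leaves. So the normal forms
evaluated at the words in a basis of `V` span. To see that they are independent, map the free
algebra to the tensor product of the model with the free associative algebra on that basis: the
second factor records the word, the first one the normal form
(`FreePartiallyAssociative.linearIndependent_normalWord`). There are `n ^ (2 p + 1)` words.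
-/

noncomputable section

universe u v w

/-! ### Identities in seven and nine letters -/

namespace IsPartiallyAssociative

variable {K : Type u} [Field K] {A : Type w} [AddCommGroup A] [Module K A]
  {μ : A →ₗ[K] A →ₗ[K] A →ₗ[K] A}

theorem left (hμ : IsPartiallyAssociative μ) (a b c d e f g : A) :
    μ (μ (μ a b c) d e) f g + μ (μ a (μ b c d) e) f g + μ (μ a b (μ c d e)) f g = 0 := by
  simpa using congrArg (fun z => μ z f g) (hμ a b c d e)

theorem middle (hμ : IsPartiallyAssociative μ) (a b c d e f g : A) :
    μ a (μ (μ b c d) e f) g + μ a (μ b (μ c d e) f) g + μ a (μ b c (μ d e f)) g = 0 := by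
  simpa using congrArg (fun z => μ a z g) (hμ b c d e f)

theorem right (hμ : IsPartiallyAssociative μ) (a b c d e f g : A) :
    μ a b (μ (μ c d e) f g) + μ a b (μ c (μ d e f) g) + μ a b (μ c d (μ e f g)) = 0 := by
  simpa using congrArg (fun z => μ a b z) (hμ c d e f g)

variable [CharZero K]

/-- The first of four two-term identities in seven letters. Partial associativity gives eight
relations between the twelve products of seven letters; in suitable half-sums of them, with signs,
all but two terms cancel. -/
theorem right_right (hμ : IsPartiallyAssociative μ) (a b c d e f g : A) :
    μ a b (μ c d (μ e f g)) = μ (μ a b c) (μ d e f) g := by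
  linear_combination (norm := module) (1 / 2 : K) • (hμ.right a b c d e f g
    + hμ.middle a b c d e f g + hμ.left a b c d e f g - hμ (μ a b c) d e f g
    - hμ a (μ b c d) e f g - hμ a b (μ c d e) f g - hμ a b c (μ d e f) g + hμ a b c d (μ e f g))

theorem right_left (hμ : IsPartiallyAssociative μ) (a b c d e f g : A) :
    μ a b (μ (μ c d e) f g) = μ a (μ b c (μ d e f)) g := by
  linear_combination (norm := module) (1 / 2 : K) • (hμ.right a b c d e f g
    - hμ.middle a b c d e f g - hμ.left a b c d e f g + hμ (μ a b c) d e f g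
    + hμ a (μ b c d) e f g + hμ a b (μ c d e) f g - hμ a b c (μ d e f) g - hμ a b c d (μ e f g))

theorem left_left (hμ : IsPartiallyAssociative μ) (a b c d e f g : A) :
    μ (μ (μ a b c) d e) f g = μ a (μ b c d) (μ e f g) := by
  linear_combination (norm := module) (1 / 2 : K) • (hμ.right a b c d e f g
    + hμ.middle a b c d e f g + hμ.left a b c d e f g + hμ (μ a b c) d e f g
    - hμ a (μ b c d) e f g - hμ a b (μ c d e) f g - hμ a b c (μ d e f) g - hμ a b c d (μ e f g))

theorem left_right (hμ : IsPartiallyAssociative μ) (a b c d e f g : A) :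
    μ (μ a b (μ c d e)) f g = μ a (μ (μ b c d) e f) g := by
  linear_combination (norm := module) (-1 / 2 : K) • (hμ.right a b c d e f g
    + hμ.middle a b c d e f g - hμ.left a b c d e f g + hμ (μ a b c) d e f g
    + hμ a (μ b c d) e f g - hμ a b (μ c d e) f g - hμ a b c (μ d e f) g - hμ a b c d (μ e f g))

/-- The three products in which two of the arguments are products themselves have sum zero. -/
theorem two_products (hμ : IsPartiallyAssociative μ) (a b c d e f g : A) :
    μ a (μ b c d) (μ e f g) + μ (μ a b c) d (μ e f g) + μ (μ a b c) (μ d e f) g = 0 := by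
  linear_combination (norm := module) hμ a b c d (μ e f g) - hμ.right_right a b c d e f g

/-- A product of three products vanishes. Repeated use of the two-term identities in seven
letters rewrites all three terms of a nested instance of `two_products` into this element, so that
its triple vanishes. -/
theorem three_products (hμ : IsPartiallyAssociative μ) (a b c d e f g h i : A) :
    μ (μ a b c) (μ d e f) (μ g h i) = 0 := by
  have h₁ : μ a (μ (μ b c d) (μ e f g) h) i = μ (μ a b c) (μ d e f) (μ g h i) := by
    rw [← hμ.right_right b c d e f g h, ← hμ.right_left, ← hμ.right_right c d e f g h i,
      hμ.right_right]
  have h₂ : μ a (μ b (μ c d e) (μ f g h)) i = μ (μ a b c) (μ d e f) (μ g h i) := by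
    rw [← hμ.left_left b c d e f g h, ← hμ.left_right, ← hμ.left_left a b c d e f g, hμ.left_left]
  have h₃ : μ a (μ (μ b c d) e (μ f g h)) i = μ (μ a b c) (μ d e f) (μ g h i) := by
    rw [← hμ.left_right, ← hμ.right_right, hμ.right_left, ← hμ.left_left,
      ← hμ.right_right a b c d e f g, hμ.left_right, h₁]
  have h₄ := congrArg (fun z => μ a z i) (hμ.two_products b c d e f g h)
  simp only [map_add, LinearMap.add_apply, h₁, h₂, h₃, map_zero, LinearMap.zero_apply] at h₄
  linear_combination (norm := module) (1 / 3 : K) • h₄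

end IsPartiallyAssociative

/-! ### Elements that annihilate the algebra -/

section Annihilator

variable {K : Type u} [Field K] {A : Type w} [AddCommGroup A] [Module K A]

/-- The elements whose product with any two elements vanishes, whatever the position. -/
def annihilator (μ : A →ₗ[K] A →ₗ[K] A →ₗ[K] A) : Submodule K A where
  carrier := {z | ∀ a b, μ z a b = 0 ∧ μ a z b = 0 ∧ μ a b z = 0}
  add_mem' hy hz a b := by
    obtain ⟨h₁, h₂, h₃⟩ := hy a b
    obtain ⟨k₁, k₂, k₃⟩ := hz a b
    simp [h₁, h₂, h₃, k₁, k₂, k₃]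
  zero_mem' a b := by simp
  smul_mem' c z hz a b := by
    obtain ⟨h₁, h₂, h₃⟩ := hz a b
    simp [h₁, h₂, h₃]

/-- An element that is a product of three elements. -/
def IsProduct (μ : A →ₗ[K] A →ₗ[K] A →ₗ[K] A) (z : A) : Prop :=
  ∃ a b c, z = μ a b c

theorem isProduct_apply (μ : A →ₗ[K] A →ₗ[K] A →ₗ[K] A) (a b c : A) : IsProduct μ (μ a b c) :=
  ⟨a, b, c, rfl⟩

end Annihilator

namespace IsPartiallyAssociative

variable {K : Type u} [Field K] [CharZero K] {A : Type w} [AddCommGroup A] [Module K A]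
  {μ : A →ₗ[K] A →ₗ[K] A →ₗ[K] A}

theorem apply_isProduct₃ (hμ : IsPartiallyAssociative μ) {x y z : A} (hx : IsProduct μ x)
    (hy : IsProduct μ y) (hz : IsProduct μ z) : μ x y z = 0 := by
  obtain ⟨a, b, c, rfl⟩ := hx
  obtain ⟨d, e, f, rfl⟩ := hy
  obtain ⟨g, h, i, rfl⟩ := hz
  exact hμ.three_products a b c d e f g h i

/-- A product in which two of the arguments are products themselves lies in the annihilator: the
two-term identities turn every product with it into a product of three products. -/
theorem isProduct_isProduct_mem (hμ : IsPartiallyAssociative μ) {x y : A} (hx : IsProduct μ x)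
    (hy : IsProduct μ y) (g : A) : μ x y g ∈ annihilator μ := by
  obtain ⟨a, b, c, rfl⟩ := hx
  obtain ⟨d, e, f, rfl⟩ := hy
  intro h i
  refine ⟨?_, ?_, ?_⟩
  · rw [← hμ.right_right a b c d e f g, hμ.left_right, ← hμ.right_right b c d e f g h,
      ← hμ.right_left, ← hμ.right_right c d e f g h i, hμ.right_right, hμ.three_products]
  · rw [← hμ.right_right a b c d e f g, ← hμ.right_left, ← hμ.right_right b c d e f g i,
      hμ.right_right, hμ.three_products]
  · rw [← hμ.right_right a b c d e f g, hμ.right_right, hμ.three_products]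

theorem mem_isProduct_isProduct (hμ : IsPartiallyAssociative μ) (a : A) {y z : A}
    (hy : IsProduct μ y) (hz : IsProduct μ z) : μ a y z ∈ annihilator μ := by
  obtain ⟨b, c, d, rfl⟩ := hy
  obtain ⟨e, f, g, rfl⟩ := hz
  intro h i
  refine ⟨?_, ?_, ?_⟩
  · rw [← hμ.left_left a b c d e f g, hμ.left_left, hμ.three_products]
  · rw [← hμ.left_left a b c d e f g, ← hμ.left_right, ← hμ.left_left h a b c d e f,
      hμ.left_left, hμ.three_products]
  · rw [← hμ.left_left a b c d e f g, hμ.right_left, ← hμ.left_left i a b c d e f,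
      ← hμ.left_right, ← hμ.left_left h i a b c d e, hμ.left_left, hμ.three_products]

/-- By `two_products`, this case follows from the other two. -/
theorem isProduct_mem_isProduct (hμ : IsPartiallyAssociative μ) {x z : A} (hx : IsProduct μ x)
    (d : A) (hz : IsProduct μ z) : μ x d z ∈ annihilator μ := by
  obtain ⟨a, b, c, rfl⟩ := hx
  obtain ⟨e, f, g, rfl⟩ := hz
  have h₁ := hμ.isProduct_isProduct_mem (isProduct_apply μ a b c) (isProduct_apply μ d e f) g
  have h₂ := hμ.mem_isProduct_isProduct a (isProduct_apply μ b c d) (isProduct_apply μ e f g)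
  have h₃ : μ (μ a b c) d (μ e f g)
      = -(μ (μ a b c) (μ d e f) g + μ a (μ b c d) (μ e f g)) := by
    linear_combination (norm := module) hμ.two_products a b c d e f g
  rw [h₃]
  exact neg_mem (add_mem h₁ h₂)

end IsPartiallyAssociative

/-! ### The multiplication table of the normal forms -/

namespace NormalForm

section Elements

variable {K : Type u} [Field K] {A : Type w} [AddCommGroup A] [Module K A]
  (μ : A →ₗ[K] A →ₗ[K] A →ₗ[K] A) (x : A)

/-- The element `u i`, obtained from `x` by applying `z ↦ μ(x, z, x)` repeatedly, `i` times. -/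
def u : ℕ → A
  | 0 => x
  | i + 1 => μ x (u i) x

/-- The element `v j = μ(x, x, u j)`, a product of `2 j + 3` factors `x`. -/
def v (j : ℕ) : A := μ x x (u μ x j)

/-- The element `s i j = μ(x, u i, v j)`, a product of `2 (i + j) + 5` factors `x`. -/
def s (i j : ℕ) : A := μ x (u μ x i) (v μ x j)

/-- The span of the normal forms with `2 p + 1` factors `x`. -/
def level (p : ℕ) : Submodule K A :=
  Submodule.span K {z | z = u μ x p ∨ (∃ j, j + 1 = p ∧ z = v μ x j) ∨
    ∃ i j, i + j + 2 = p ∧ z = s μ x i j}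

theorem u_mem_level {p q : ℕ} (h : p = q) : u μ x p ∈ level μ x q :=
  Submodule.subset_span (Or.inl (h ▸ rfl))

theorem v_mem_level {j p : ℕ} (h : j + 1 = p) : v μ x j ∈ level μ x p :=
  Submodule.subset_span (Or.inr (Or.inl ⟨j, h, rfl⟩))

theorem s_mem_level {i j p : ℕ} (h : i + j + 2 = p) : s μ x i j ∈ level μ x p :=
  Submodule.subset_span (Or.inr (Or.inr ⟨i, j, h, rfl⟩))

/-- The normal forms with `2 p + 1` factors, except `x` and those that lie in the annihilator of
every partially associative algebra. -/
def IsMain (p : ℕ) (z : A) : Prop :=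
  (∃ k, p = k + 1 ∧ z = u μ x (k + 1)) ∨ ∃ k, p = k + 2 ∧ z = v μ x (k + 1)

theorem isProduct_u (i : ℕ) : IsProduct μ (u μ x (i + 1)) := isProduct_apply μ _ _ _

theorem isProduct_v (j : ℕ) : IsProduct μ (v μ x j) := isProduct_apply μ _ _ _

theorem IsMain.isProduct {p : ℕ} {z : A} (h : IsMain μ x p z) : IsProduct μ z := by
  rcases h with ⟨k, -, rfl⟩ | ⟨k, -, rfl⟩
  · exact isProduct_u μ x k
  · exact isProduct_v μ x (k + 1)

end Elements

section Table

variable {K : Type u} [Field K] [CharZero K] {A : Type w} [AddCommGroup A] [Module K A]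
  {μ : A →ₗ[K] A →ₗ[K] A →ₗ[K] A} (hμ : IsPartiallyAssociative μ) (x : A)

include hμ

theorem s_succ_mem (i j : ℕ) : s μ x (i + 1) j ∈ annihilator μ :=
  hμ.mem_isProduct_isProduct x (isProduct_u μ x i) (isProduct_v μ x j)

theorem s_zero_succ_mem (j : ℕ) : s μ x 0 (j + 1) ∈ annihilator μ := by
  have h₁ := hμ.isProduct_mem_isProduct (isProduct_apply μ x x x) x (isProduct_u μ x j)
  have h₂ := hμ.mem_isProduct_isProduct x (isProduct_apply μ x x x) (isProduct_u μ x j)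
  have h₃ : s μ x 0 (j + 1)
      = -(μ (μ x x x) x (u μ x (j + 1)) + μ x (μ x x x) (u μ x (j + 1))) := by
    simp only [s, v, u.eq_1]
    linear_combination (norm := module) hμ x x x x (u μ x (j + 1))
  rw [h₃]
  exact neg_mem (add_mem h₁ h₂)

/-- Both terms lie in the annihilator unless `i = 0`, and then they cancel. -/
theorem correction_mem (i : ℕ) : (-1 : K) ^ i • s μ x 0 i - s μ x i 0 ∈ annihilator μ := by
  cases i with
  | zero => simp
  | succ i =>
    exact sub_mem (Submodule.smul_mem _ _ (s_zero_succ_mem hμ x i)) (s_succ_mem hμ x i 0)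

theorem left_product_right_unit {a b : A} (ha : IsProduct μ a) (hb : IsProduct μ b) :
    μ x a (μ b x x) = 0 := by
  have h₁ := (hμ.mem_isProduct_isProduct x ha hb x x).1
  have h₂ := (hμ.isProduct_isProduct_mem ha hb x x x).2.1
  linear_combination (norm := module) hμ x a b x x - h₁ - h₂

theorem product_right_unit_right {a b : A} (ha : IsProduct μ a) (hb : IsProduct μ b) :
    μ a (μ b x x) x = 0 := by
  have h₁ := (hμ.isProduct_isProduct_mem ha hb x x x).1
  have h₂ := hμ.apply_isProduct₃ ha hb (isProduct_apply μ x x x)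
  linear_combination (norm := module) hμ a b x x x - h₁ - h₂

/-- The products `μ(u (i + 1), x, x)` and `μ(u 1, u (i + 1), x)`; each of the two formulas is
needed in the inductive step of the other. -/
theorem u_apply_apply_and (i : ℕ) :
    μ (u μ x (i + 1)) x x = (-1 : K) ^ (i + 1) • u μ x (i + 2) - v μ x (i + 1)
        + ((-1 : K) ^ i • s μ x 0 i - s μ x i 0) ∧
      μ (μ x x x) (u μ x (i + 1)) x = (-1 : K) ^ i • s μ x 0 (i + 1) := by
  induction i with
  | zero =>
    constructor
    · have h := hμ x x x x x
      simp only [v, u, pow_zero, one_smul, sub_self]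
      linear_combination (norm := module) h
    · simpa [s, v, u] using (hμ.right_right x x x x x x x).symm
  | succ i ih =>
    obtain ⟨h₁, h₂⟩ := ih
    have hz := correction_mem hμ x i
    generalize (-1 : K) ^ i • s μ x 0 i - s μ x i 0 = z at h₁ hz
    constructor
    · have k₁ := hμ x (u μ x (i + 1)) x x x
      have k₂ := hμ x x x (u μ x (i + 1)) x
      have k₃ := congrArg (fun z => μ x z x) h₁
      simp only [map_add, LinearMap.add_apply, (hz x x).2.1, map_sub, LinearMap.sub_apply,
        map_smul, LinearMap.smul_apply] at k₃
      have e₁ : u μ x (i + 2) = μ x (u μ x (i + 1)) x := rfl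
      have e₂ : v μ x (i + 1) = μ x x (u μ x (i + 1)) := rfl
      have e₃ : s μ x (i + 1) 0 = μ x (u μ x (i + 1)) (μ x x x) := rfl
      have e₄ : u μ x (i + 3) = μ x (u μ x (i + 2)) x := rfl
      have e₅ : v μ x (i + 2) = μ x x (u μ x (i + 2)) := rfl
      rw [e₂] at k₃
      rw [← e₁] at k₁ k₂
      rw [e₃, e₄, e₅]
      linear_combination (norm := module) k₁ - k₃ + k₂ - h₂
    · have hw := isProduct_apply μ x x x
      have k₁ := hμ (μ x x x) x (u μ x (i + 1)) x x
      have k₂ := (hμ.isProduct_mem_isProduct hw x (isProduct_u μ x i) x x).1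
      have k₃ := hμ x x x x (μ (u μ x (i + 1)) x x)
      have k₄ := left_product_right_unit hμ x hw (isProduct_u μ x i)
      have k₅ := congrArg (fun z => μ x x (μ x x z)) h₁
      have k₆ := (s_zero_succ_mem hμ x i x x).2.2
      simp only [map_add, map_sub, map_smul, (hz x x).2.2, map_zero] at k₅
      have e₁ : u μ x (i + 2) = μ x (u μ x (i + 1)) x := rfl
      have e₂ : s μ x 0 (i + 2) = μ x x (μ x x (u μ x (i + 2))) := rfl
      have e₃ : s μ x 0 (i + 1) = μ x x (v μ x (i + 1)) := rfl
      rw [← e₁] at k₁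
      rw [e₃] at k₆
      rw [e₂]
      linear_combination (norm := module) k₁ - k₂ - k₃ + k₄ + k₅ - k₆

theorem exists_u_apply_apply (i : ℕ) : ∃ z ∈ annihilator μ,
    μ (u μ x (i + 1)) x x = (-1 : K) ^ (i + 1) • u μ x (i + 2) - v μ x (i + 1) + z :=
  ⟨_, correction_mem hμ x i, (u_apply_apply_and hμ x i).1⟩

theorem apply_u_u (i j : ℕ) :
    μ x (u μ x (i + 1)) (u μ x (j + 1)) = (-1 : K) ^ j • s μ x (i + 1) j := by
  cases j with
  | zero => simp [s, v, u]
  | succ j =>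
    have h := left_product_right_unit hμ x (isProduct_u μ x i) (isProduct_u μ x j)
    obtain ⟨z, hz, hj⟩ := exists_u_apply_apply hμ x j
    simp only [hj, map_add, map_sub, map_smul, (hz _ _).2.2, add_zero, sub_eq_zero] at h
    rw [s, ← h, smul_smul, ← mul_pow]
    simp

theorem u_u_apply (i j : ℕ) :
    μ (u μ x (i + 1)) (u μ x (j + 1)) x = (-1 : K) ^ j • s μ x i (j + 1) := by
  cases i with
  | zero => exact (u_apply_apply_and hμ x j).2
  | succ i =>
    have h₁ := hμ x (u μ x (i + 1)) x (u μ x (j + 1)) x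
    have h₂ := (hμ.isProduct_mem_isProduct (isProduct_u μ x i) x (isProduct_u μ x j) x x).2.1
    have h₃ := apply_u_u hμ x i (j + 1)
    have e₁ : u μ x (i + 2) = μ x (u μ x (i + 1)) x := rfl
    have e₂ : u μ x (j + 2) = μ x (u μ x (j + 1)) x := rfl
    rw [← e₁, ← e₂] at h₁
    linear_combination (norm := module) h₁ - h₂ - h₃

theorem u_v_apply (i j : ℕ) :
    μ (u μ x (i + 1)) (v μ x (j + 1)) x = s μ x i (j + 2) := by
  have h := product_right_unit_right hμ x (isProduct_u μ x i) (isProduct_u μ x j)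
  obtain ⟨z, hz, hj⟩ := exists_u_apply_apply hμ x j
  simp only [hj, map_add, map_sub, map_smul, LinearMap.add_apply, LinearMap.sub_apply,
    LinearMap.smul_apply, (hz _ _).2.1, add_zero, sub_eq_zero, u_u_apply hμ, smul_smul,
    ← mul_pow] at h
  simpa using h.symm

theorem apply_v_product (i : ℕ) {b : A} (hb : IsProduct μ b) : μ x (v μ x (i + 1)) b = 0 := by
  have h₁ := hμ x x x (u μ x (i + 1)) b
  have h₂ := hμ.apply_isProduct₃ (isProduct_apply μ x x x) (isProduct_u μ x i) hb
  have h₃ := (hμ.mem_isProduct_isProduct x (isProduct_u μ x i) hb x x).2.2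
  rw [v]
  linear_combination (norm := module) h₁ - h₂ - h₃

theorem v_product_apply (i : ℕ) {b : A} (hb : IsProduct μ b) : μ (v μ x (i + 1)) b x = 0 := by
  have h₁ := hμ x x (u μ x (i + 1)) b x
  have h₂ := (hμ.mem_isProduct_isProduct x (isProduct_u μ x i) hb x x).2.1
  have h₃ := (hμ.isProduct_isProduct_mem (isProduct_u μ x i) hb x x x).2.2
  rw [v]
  linear_combination (norm := module) h₁ - h₂ - h₃

theorem v_apply_product (i : ℕ) {b : A} (hb : IsProduct μ b) :
    μ (v μ x (i + 1)) x b = -μ x (u μ x (i + 2)) b := by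
  have h₁ := hμ x x (u μ x (i + 1)) x b
  have h₂ := (hμ.isProduct_mem_isProduct (isProduct_u μ x i) x hb x x).2.2
  have e₁ : u μ x (i + 2) = μ x (u μ x (i + 1)) x := rfl
  rw [v, e₁]
  linear_combination (norm := module) h₁ - h₂

omit [CharZero K] in
theorem u_one_apply (b : A) : μ (u μ x 1) x b = -μ x (u μ x 1) b - μ x x (μ x x b) := by
  simp only [u]
  linear_combination (norm := module) hμ x x x x b

theorem u_apply_product (i : ℕ) {b : A} (hb : IsProduct μ b) :
    μ (u μ x (i + 2)) x b
      = (-1 : K) ^ i • μ x (u μ x (i + 2)) b - μ x (u μ x (i + 1)) (μ x x b) := by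
  have h₁ := hμ x (u μ x (i + 1)) x x b
  obtain ⟨z, hz, hi⟩ := exists_u_apply_apply hμ x i
  simp only [hi, map_add, map_sub, map_smul, LinearMap.add_apply, LinearMap.sub_apply,
    LinearMap.smul_apply, (hz _ _).2.1, apply_v_product hμ x i hb] at h₁
  have e₁ : u μ x (i + 2) = μ x (u μ x (i + 1)) x := rfl
  rw [← e₁] at h₁
  linear_combination (norm := module) h₁

theorem apply_v_apply (i : ℕ) :
    μ x (v μ x (i + 1)) x = -v μ x (i + 2) - (-1 : K) ^ i • s μ x 0 (i + 1) := by
  have h := hμ x x x (u μ x (i + 1)) x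
  have e₁ : v μ x (i + 2) = μ x x (μ x (u μ x (i + 1)) x) := rfl
  rw [e₁, v, ← (u_apply_apply_and hμ x i).2]
  linear_combination (norm := module) h

theorem v_apply_apply (i : ℕ) : μ (v μ x (i + 1)) x x
    = -u μ x (i + 3) + (-1 : K) ^ i • v μ x (i + 2) + s μ x 0 (i + 1) := by
  have h := hμ x x (u μ x (i + 1)) x x
  obtain ⟨z, hz, hi⟩ := exists_u_apply_apply hμ x i
  simp only [hi, map_add, map_sub, map_smul, (hz _ _).2.2] at h
  rw [v, v, s, u, u]
  simp only [u] at h ⊢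
  linear_combination (norm := module) h

/-- Because of the coincidences `v 0 = u 1` and `s 0 0 = v 1`, the elements `v 0` and `s 0 0` fall
under `IsMain`. -/
theorem generator_cases {p : ℕ} {z : A} (hz : z = u μ x p ∨ (∃ j, j + 1 = p ∧ z = v μ x j) ∨
    ∃ i j, i + j + 2 = p ∧ z = s μ x i j) :
    (p = 0 ∧ z = x) ∨ IsMain μ x p z ∨ z ∈ annihilator μ := by
  rcases hz with rfl | ⟨j, rfl, rfl⟩ | ⟨i, j, rfl, rfl⟩
  · cases p with
    | zero => exact Or.inl ⟨rfl, rfl⟩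
    | succ k => exact Or.inr (Or.inl (Or.inl ⟨k, rfl, rfl⟩))
  · cases j with
    | zero => exact Or.inr (Or.inl (Or.inl ⟨0, rfl, rfl⟩))
    | succ k => exact Or.inr (Or.inl (Or.inr ⟨k, rfl, rfl⟩))
  · cases i with
    | zero =>
      cases j with
      | zero => exact Or.inr (Or.inl (Or.inr ⟨0, rfl, rfl⟩))
      | succ j => exact Or.inr (Or.inr (s_zero_succ_mem hμ x j))
    | succ i => exact Or.inr (Or.inr (s_succ_mem hμ x i j))

section Main

variable {x} {p q : ℕ} {a b : A}

omit hμ [CharZero K] in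
theorem apply_apply_main_mem (ha : IsMain μ x p a) : μ x x a ∈ level μ x (p + 1) := by
  rcases ha with ⟨k, rfl, rfl⟩ | ⟨k, rfl, rfl⟩
  · exact v_mem_level μ x (by omega)
  · exact s_mem_level μ x (i := 0) (by omega)

theorem apply_main_apply_mem (ha : IsMain μ x p a) : μ x a x ∈ level μ x (p + 1) := by
  rcases ha with ⟨k, rfl, rfl⟩ | ⟨k, rfl, rfl⟩
  · exact u_mem_level μ x (p := k + 2) (by omega)
  · rw [apply_v_apply hμ]
    exact sub_mem (neg_mem (v_mem_level μ x (by omega)))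
      (Submodule.smul_mem _ _ (s_mem_level μ x (by omega)))

theorem main_apply_apply_mem (ha : IsMain μ x p a) : μ a x x ∈ level μ x (p + 1) := by
  rcases ha with ⟨k, rfl, rfl⟩ | ⟨k, rfl, rfl⟩
  · rw [(u_apply_apply_and hμ x k).1]
    refine add_mem (sub_mem (Submodule.smul_mem _ _ (u_mem_level μ x (by omega)))
      (v_mem_level μ x (by omega))) ?_
    cases k with
    | zero => simp
    | succ k =>
      exact sub_mem (Submodule.smul_mem _ _ (s_mem_level μ x (by omega)))
        (s_mem_level μ x (by omega))
  · rw [v_apply_apply hμ]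
    exact add_mem (add_mem (neg_mem (u_mem_level μ x (by omega)))
      (Submodule.smul_mem _ _ (v_mem_level μ x (by omega)))) (s_mem_level μ x (by omega))

theorem apply_main_main_mem (ha : IsMain μ x p a) (hb : IsMain μ x q b) :
    μ x a b ∈ level μ x (p + q + 1) := by
  rcases ha with ⟨i, rfl, rfl⟩ | ⟨i, rfl, rfl⟩
  · rcases hb with ⟨j, rfl, rfl⟩ | ⟨j, rfl, rfl⟩
    · rw [apply_u_u hμ]
      exact Submodule.smul_mem _ _ (s_mem_level μ x (by omega))
    · exact s_mem_level μ x (by omega)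
  · rw [apply_v_product hμ x i hb.isProduct]
    exact zero_mem _

theorem main_main_apply_mem (ha : IsMain μ x p a) (hb : IsMain μ x q b) :
    μ a b x ∈ level μ x (p + q + 1) := by
  rcases ha with ⟨i, rfl, rfl⟩ | ⟨i, rfl, rfl⟩
  · rcases hb with ⟨j, rfl, rfl⟩ | ⟨j, rfl, rfl⟩
    · rw [u_u_apply hμ]
      exact Submodule.smul_mem _ _ (s_mem_level μ x (by omega))
    · rw [u_v_apply hμ]
      exact s_mem_level μ x (by omega)
  · rw [v_product_apply hμ x i hb.isProduct]
    exact zero_mem _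

theorem main_apply_main_mem (ha : IsMain μ x p a) (hb : IsMain μ x q b) :
    μ a x b ∈ level μ x (p + q + 1) := by
  have hxx : ∀ i, μ x (u μ x i) (μ x x b) ∈ level μ x (i + q + 2) := by
    intro i
    rcases hb with ⟨j, rfl, rfl⟩ | ⟨j, rfl, rfl⟩
    · exact s_mem_level μ x (j := j + 1) (by omega)
    · rw [show μ x x (v μ x (j + 1)) = s μ x 0 (j + 1) from rfl,
        (s_zero_succ_mem hμ x j x _).2.2]
      exact zero_mem _
  rcases ha with ⟨i, rfl, rfl⟩ | ⟨i, rfl, rfl⟩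
  · have h := apply_main_main_mem hμ (Or.inl ⟨i, rfl, rfl⟩ : IsMain μ x (i + 1) _) hb
    cases i with
    | zero =>
      rw [u_one_apply hμ]
      have h₀ := hxx 0
      rw [show 0 + q + 2 = 0 + 1 + q + 1 by omega] at h₀
      exact sub_mem (neg_mem h) h₀
    | succ i =>
      rw [u_apply_product hμ x i hb.isProduct]
      have h₀ := hxx (i + 1)
      rw [show i + 1 + q + 2 = i + 1 + 1 + q + 1 by omega] at h₀
      exact sub_mem (Submodule.smul_mem _ _ h) h₀
  · rw [v_apply_product hμ x i hb.isProduct]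
    exact neg_mem (apply_main_main_mem hμ (Or.inl ⟨i + 1, rfl, rfl⟩) hb)

end Main

theorem generator_mul_mem {p q r : ℕ} {a b c : A}
    (ha : a = u μ x p ∨ (∃ j, j + 1 = p ∧ a = v μ x j) ∨ ∃ i j, i + j + 2 = p ∧ a = s μ x i j)
    (hb : b = u μ x q ∨ (∃ j, j + 1 = q ∧ b = v μ x j) ∨ ∃ i j, i + j + 2 = q ∧ b = s μ x i j)
    (hc : c = u μ x r ∨ (∃ j, j + 1 = r ∧ c = v μ x j) ∨ ∃ i j, i + j + 2 = r ∧ c = s μ x i j) :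
    μ a b c ∈ level μ x (p + q + r + 1) := by
  obtain ha' | ha' := or_assoc.2 (generator_cases hμ x ha)
  swap
  · simp [(ha' b c).1]
  obtain hb' | hb' := or_assoc.2 (generator_cases hμ x hb)
  swap
  · simp [(hb' a c).2.1]
  obtain hc' | hc' := or_assoc.2 (generator_cases hμ x hc)
  swap
  · simp [(hc' a b).2.2]
  clear ha hb hc
  rcases ha' with ⟨rfl, ha⟩ | ha <;> rcases hb' with ⟨rfl, hb⟩ | hb <;>
    rcases hc' with ⟨rfl, hc⟩ | hc
  · rw [ha, hb, hc]
    exact u_mem_level μ x (p := 1) rfl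
  · rw [ha, hb]
    simpa using apply_apply_main_mem hc
  · rw [ha, hc]
    simpa using apply_main_apply_mem hμ hb
  · rw [ha]
    simpa using apply_main_main_mem hμ hb hc
  · rw [hb, hc]
    simpa using main_apply_apply_mem hμ ha
  · rw [hb]
    simpa using main_apply_main_mem hμ ha hc
  · rw [hc]
    simpa using main_main_apply_mem hμ ha hb
  · simp [hμ.apply_isProduct₃ ha.isProduct hb.isProduct hc.isProduct]

/-- The normal forms span a graded subalgebra. -/
theorem mul_mem_level {p q r : ℕ} {a b c : A} (ha : a ∈ level μ x p) (hb : b ∈ level μ x q)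
    (hc : c ∈ level μ x r) : μ a b c ∈ level μ x (p + q + r + 1) := by
  induction ha using Submodule.span_induction with
  | zero => simp
  | add a a' _ _ h h' => simpa using add_mem h h'
  | smul k a _ h => simpa using Submodule.smul_mem _ k h
  | mem a ha =>
    induction hb using Submodule.span_induction with
    | zero => simp
    | add b b' _ _ h h' => simpa using add_mem h h'
    | smul k b _ h => simpa using Submodule.smul_mem _ k h
    | mem b hb =>
      induction hc using Submodule.span_induction with
      | zero => simp
      | add c c' _ _ h h' => simpa using add_mem h h'
      | smul k c _ h => simpa using Submodule.smul_mem _ k h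
      | mem c hc => exact generator_mul_mem hμ x ha hb hc

end Table

end NormalForm

/-! ### The linear maps that define the model -/

/-- The indices of the basis elements of degree greater than one of the model; in the notation of
`NormalForm`, the basis elements `u i`, `v i`, `s i j` of the model stand for `u (i + 1)`,
`v (i + 1)` and `s i j`. (The vector indexed by `s 0 0` is not reached by the product.) -/
inductive ModelIndex : Type
  | u : ℕ → ModelIndex
  | v : ℕ → ModelIndex
  | s : ℕ → ℕ → ModelIndex

namespace Model

variable (K : Type u) [Field K]

/-- The basis vector with a given index. -/
def e (a : ModelIndex) : ModelIndex →₀ K := Finsupp.single a 1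

open ModelIndex in
/-- The values of `L₁` on the basis, taken, like those of the other five maps, from the
multiplication table of the normal forms. -/
def l₁ : ModelIndex → ModelIndex →₀ K
  | u i => e K (v i)
  | v i => e K (s 0 (i + 1))
  | s _ _ => 0

open ModelIndex in
/-- The values of `L₂` on the basis. -/
def l₂ : ModelIndex → ModelIndex →₀ K
  | u i => e K (u (i + 1))
  | v i => -e K (v (i + 1)) - (-1 : K) ^ i • e K (s 0 (i + 1))
  | s _ _ => 0

open ModelIndex in
/-- The values of `L₃` on the basis. -/
def l₃ : ModelIndex → ModelIndex →₀ K
  | u i => -(-1 : K) ^ i • e K (u (i + 1)) - e K (v i) - e K (s i 0) + (-1 : K) ^ i • e K (s 0 i)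
  | v i => -e K (u (i + 2)) + (-1 : K) ^ i • e K (v (i + 1)) + e K (s 0 (i + 1))
  | s _ _ => 0

open ModelIndex in
/-- The values of `B₁` on the basis. -/
def b₁ : ModelIndex → ModelIndex → ModelIndex →₀ K
  | u i, u j => (-1 : K) ^ j • e K (s (i + 1) j)
  | u i, v j => e K (s (i + 1) (j + 1))
  | u _, s _ _ => 0
  | v _, _ => 0
  | s _ _, _ => 0

open ModelIndex in
/-- The values of `B₂` on the basis. -/
def b₂ : ModelIndex → ModelIndex → ModelIndex →₀ K
  | u i, u j => -(-1 : K) ^ (i + j) • e K (s (i + 1) j) - e K (s i (j + 1))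
  | u i, v j => -(-1 : K) ^ i • e K (s (i + 1) (j + 1))
  | v i, u j => -(-1 : K) ^ j • e K (s (i + 2) j)
  | v i, v j => -e K (s (i + 2) (j + 1))
  | u _, s _ _ => 0
  | v _, s _ _ => 0
  | s _ _, _ => 0

open ModelIndex in
/-- The values of `B₃` on the basis. -/
def b₃ : ModelIndex → ModelIndex → ModelIndex →₀ K
  | u i, u j => (-1 : K) ^ j • e K (s i (j + 1))
  | u i, v j => e K (s i (j + 2))
  | u _, s _ _ => 0
  | v _, _ => 0
  | s _ _, _ => 0

/-- The map `z ↦ μ(x, x, z)` of the model, where `x` is the generator and `μ` the product. -/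
def L₁ : (ModelIndex →₀ K) →ₗ[K] ModelIndex →₀ K := Finsupp.linearCombination K (l₁ K)

/-- The map `z ↦ μ(x, z, x)`. -/
def L₂ : (ModelIndex →₀ K) →ₗ[K] ModelIndex →₀ K := Finsupp.linearCombination K (l₂ K)

/-- The map `z ↦ μ(z, x, x)`. -/
def L₃ : (ModelIndex →₀ K) →ₗ[K] ModelIndex →₀ K := Finsupp.linearCombination K (l₃ K)

/-- The map `(y, z) ↦ μ(x, y, z)`. -/
def B₁ : (ModelIndex →₀ K) →ₗ[K] (ModelIndex →₀ K) →ₗ[K] ModelIndex →₀ K :=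
  Finsupp.linearCombination K fun a => Finsupp.linearCombination K (b₁ K a)

/-- The map `(y, z) ↦ μ(y, x, z)`. -/
def B₂ : (ModelIndex →₀ K) →ₗ[K] (ModelIndex →₀ K) →ₗ[K] ModelIndex →₀ K :=
  Finsupp.linearCombination K fun a => Finsupp.linearCombination K (b₂ K a)

/-- The map `(y, z) ↦ μ(y, z, x)`. -/
def B₃ : (ModelIndex →₀ K) →ₗ[K] (ModelIndex →₀ K) →ₗ[K] ModelIndex →₀ K :=
  Finsupp.linearCombination K fun a => Finsupp.linearCombination K (b₃ K a)

variable {K}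

theorem L₁_e (a : ModelIndex) : L₁ K (e K a) = l₁ K a := by simp [L₁, e]

theorem L₂_e (a : ModelIndex) : L₂ K (e K a) = l₂ K a := by simp [L₂, e]

theorem L₃_e (a : ModelIndex) : L₃ K (e K a) = l₃ K a := by simp [L₃, e]

theorem B₁_e (a b : ModelIndex) : B₁ K (e K a) (e K b) = b₁ K a b := by simp [B₁, e]

theorem B₂_e (a b : ModelIndex) : B₂ K (e K a) (e K b) = b₂ K a b := by simp [B₂, e]

theorem B₃_e (a b : ModelIndex) : B₃ K (e K a) (e K b) = b₃ K a b := by simp [B₃, e]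

theorem eq_zero_of_apply_e {f : (ModelIndex →₀ K) →ₗ[K] ModelIndex →₀ K}
    (h : ∀ a, f (e K a) = 0) (y : ModelIndex →₀ K) : f y = 0 := by
  have : f = 0 := Finsupp.lhom_ext' fun a => LinearMap.ext_ring (h a)
  simp [this]

theorem eq_zero_of_apply_e_e {f : (ModelIndex →₀ K) →ₗ[K] (ModelIndex →₀ K) →ₗ[K] ModelIndex →₀ K}
    (h : ∀ a b, f (e K a) (e K b) = 0) (y z : ModelIndex →₀ K) : f y z = 0 := by
  have : f = 0 := Finsupp.lhom_ext' fun a => LinearMap.ext_ring (LinearMap.ext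
    (eq_zero_of_apply_e (h a)))
  simp [this]

section Conditions

/-! These are the instances of partial associativity in which one, two or no arguments are
different from `x`; all other instances hold because each of their three terms vanishes. -/

theorem L_u_zero : L₃ K (e K (.u 0)) + L₂ K (e K (.u 0)) + L₁ K (e K (.u 0)) = 0 := by
  simp only [L₁_e, l₁, L₂_e, l₂, L₃_e, l₃]
  module

variable (y z : ModelIndex →₀ K)

theorem B_apply_u_zero : L₃ K (L₃ K y) + B₃ K y (e K (.u 0)) + B₂ K y (e K (.u 0)) = 0 := by
  refine eq_zero_of_apply_e
    (f := L₃ K ∘ₗ L₃ K + (B₃ K).flip (e K (.u 0)) + (B₂ K).flip (e K (.u 0))) ?_ y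
  rintro (i | i | ⟨i, j⟩) <;> obtain h | h := neg_one_pow_eq_or K i <;>
    simp [L₃_e, l₃, B₂_e, b₂, B₃_e, b₃, h, pow_succ] <;> module

theorem L₃_L₂ : L₃ K (L₂ K y) + L₂ K (L₃ K y) + B₁ K y (e K (.u 0)) = 0 := by
  refine eq_zero_of_apply_e (f := L₃ K ∘ₗ L₂ K + L₂ K ∘ₗ L₃ K + (B₁ K).flip (e K (.u 0))) ?_ y
  rintro (i | i | ⟨i, j⟩) <;> obtain h | h := neg_one_pow_eq_or K i <;>
    simp [L₂_e, l₂, L₃_e, l₃, B₁_e, b₁, h, pow_succ] <;> module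

theorem L₃_L₁ : L₃ K (L₁ K y) + L₂ K (L₂ K y) + L₁ K (L₃ K y) = 0 := by
  refine eq_zero_of_apply_e (f := L₃ K ∘ₗ L₁ K + L₂ K ∘ₗ L₂ K + L₁ K ∘ₗ L₃ K) ?_ y
  rintro (i | i | ⟨i, j⟩) <;> obtain h | h := neg_one_pow_eq_or K i <;>
    simp [L₁_e, l₁, L₂_e, l₂, L₃_e, l₃, h, pow_succ] <;> module

theorem L₂_L₁ : B₃ K (e K (.u 0)) y + L₂ K (L₁ K y) + L₁ K (L₂ K y) = 0 := by
  refine eq_zero_of_apply_e (f := B₃ K (e K (.u 0)) + L₂ K ∘ₗ L₁ K + L₁ K ∘ₗ L₂ K) ?_ y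
  rintro (i | i | ⟨i, j⟩) <;> obtain h | h := neg_one_pow_eq_or K i <;>
    simp [L₁_e, l₁, L₂_e, l₂, B₃_e, b₃, h]

theorem L₁_L₁ : B₂ K (e K (.u 0)) y + B₁ K (e K (.u 0)) y + L₁ K (L₁ K y) = 0 := by
  refine eq_zero_of_apply_e (f := B₂ K (e K (.u 0)) + B₁ K (e K (.u 0)) + L₁ K ∘ₗ L₁ K) ?_ y
  rintro (i | i | ⟨i, j⟩) <;> obtain h | h := neg_one_pow_eq_or K i <;>
    simp [L₁_e, l₁, B₁_e, b₁, B₂_e, b₂, h] <;> module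

theorem B₃_apply_L₃ : B₃ K y (L₃ K z) = 0 := by
  refine eq_zero_of_apply_e_e (f := (B₃ K).compl₂ (L₃ K)) ?_ y z
  rintro (i | i | ⟨i, j⟩) (i' | i' | ⟨i', j'⟩) <;> obtain h' | h' := neg_one_pow_eq_or K i' <;>
    simp [L₃_e, l₃, B₃_e, b₃, h', pow_succ]

theorem B₃_apply_L₂ : B₃ K y (L₂ K z) + B₂ K y (L₃ K z) = 0 := by
  refine eq_zero_of_apply_e_e (f := (B₃ K).compl₂ (L₂ K) + (B₂ K).compl₂ (L₃ K)) ?_ y z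
  rintro (i | i | ⟨i, j⟩) (i' | i' | ⟨i', j'⟩) <;> obtain h | h := neg_one_pow_eq_or K i <;>
    obtain h' | h' := neg_one_pow_eq_or K i' <;>
    simp [L₂_e, l₂, L₃_e, l₃, B₂_e, b₂, B₃_e, b₃, h, h', pow_succ, pow_add]
  module

theorem B₃_L₃ : B₃ K (L₃ K y) z + B₃ K y (L₁ K z) + B₂ K y (L₂ K z) = 0 := by
  refine eq_zero_of_apply_e_e
    (f := B₃ K ∘ₗ L₃ K + (B₃ K).compl₂ (L₁ K) + (B₂ K).compl₂ (L₂ K)) ?_ y z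
  rintro (i | i | ⟨i, j⟩) (i' | i' | ⟨i', j'⟩) <;> obtain h | h := neg_one_pow_eq_or K i <;>
    obtain h' | h' := neg_one_pow_eq_or K i' <;>
    simp [L₁_e, l₁, L₂_e, l₂, L₃_e, l₃, B₂_e, b₂, B₃_e, b₃, h, h', pow_succ, pow_add]

theorem B₂_L₃ : B₂ K (L₃ K y) z + B₂ K y (L₁ K z) = 0 := by
  refine eq_zero_of_apply_e_e (f := B₂ K ∘ₗ L₃ K + (B₂ K).compl₂ (L₁ K)) ?_ y z
  rintro (i | i | ⟨i, j⟩) (i' | i' | ⟨i', j'⟩) <;> obtain h | h := neg_one_pow_eq_or K i <;>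
    obtain h' | h' := neg_one_pow_eq_or K i' <;>
    simp [L₁_e, l₁, L₃_e, l₃, B₂_e, b₂, h, h', pow_succ, pow_add]
  module

theorem B₁_apply_L₃ : B₁ K y (L₃ K z) = 0 := by
  refine eq_zero_of_apply_e_e (f := (B₁ K).compl₂ (L₃ K)) ?_ y z
  rintro (i | i | ⟨i, j⟩) (i' | i' | ⟨i', j'⟩) <;> obtain h' | h' := neg_one_pow_eq_or K i' <;>
    simp [L₃_e, l₃, B₁_e, b₁, h', pow_succ]

theorem B₃_L₂ : B₃ K (L₂ K y) z + B₁ K y (L₂ K z) = 0 := by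
  refine eq_zero_of_apply_e_e (f := B₃ K ∘ₗ L₂ K + (B₁ K).compl₂ (L₂ K)) ?_ y z
  rintro (i | i | ⟨i, j⟩) (i' | i' | ⟨i', j'⟩) <;> obtain h | h := neg_one_pow_eq_or K i <;>
    obtain h' | h' := neg_one_pow_eq_or K i' <;>
    simp [L₂_e, l₂, B₁_e, b₁, B₃_e, b₃, h, h', pow_succ]

theorem B₂_L₂ : B₂ K (L₂ K y) z + B₁ K (L₃ K y) z + B₁ K y (L₁ K z) = 0 := by
  refine eq_zero_of_apply_e_e
    (f := B₂ K ∘ₗ L₂ K + B₁ K ∘ₗ L₃ K + (B₁ K).compl₂ (L₁ K)) ?_ y z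
  rintro (i | i | ⟨i, j⟩) (i' | i' | ⟨i', j'⟩) <;> obtain h | h := neg_one_pow_eq_or K i <;>
    obtain h' | h' := neg_one_pow_eq_or K i' <;>
    simp [L₁_e, l₁, L₂_e, l₂, L₃_e, l₃, B₁_e, b₁, B₂_e, b₂, h, h', pow_succ, pow_add] <;> module

theorem B₃_L₁ : B₃ K (L₁ K y) z = 0 := by
  refine eq_zero_of_apply_e_e (f := B₃ K ∘ₗ L₁ K) ?_ y z
  rintro (i | i | ⟨i, j⟩) (i' | i' | ⟨i', j'⟩) <;>
    simp [L₁_e, l₁, B₃_e, b₃]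

theorem B₂_L₁ : B₂ K (L₁ K y) z + B₁ K (L₂ K y) z = 0 := by
  refine eq_zero_of_apply_e_e (f := B₂ K ∘ₗ L₁ K + B₁ K ∘ₗ L₂ K) ?_ y z
  rintro (i | i | ⟨i, j⟩) (i' | i' | ⟨i', j'⟩) <;> obtain h | h := neg_one_pow_eq_or K i <;>
    obtain h' | h' := neg_one_pow_eq_or K i' <;>
    simp [L₁_e, l₁, L₂_e, l₂, B₁_e, b₁, B₂_e, b₂, h, h']

theorem B₁_L₁ : B₁ K (L₁ K y) z = 0 := by
  refine eq_zero_of_apply_e_e (f := B₁ K ∘ₗ L₁ K) ?_ y z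
  rintro (i | i | ⟨i, j⟩) (i' | i' | ⟨i', j'⟩) <;>
    simp [L₁_e, l₁, B₁_e, b₁]

end Conditions

/-- The span of the basis vectors `s i j`. -/
def sSpan (K : Type u) [Field K] : Submodule K (ModelIndex →₀ K) :=
  Submodule.span K (Set.range fun ij : ℕ × ℕ => e K (.s ij.1 ij.2))

/-- The six maps vanish as soon as one argument is in `sSpan K`; in particular they vanish on all
values of `B₁`, `B₂` and `B₃`. -/
theorem apply_eq_zero_of_mem_sSpan {y : ModelIndex →₀ K} (hy : y ∈ sSpan K) :
    (L₁ K y = 0 ∧ L₂ K y = 0 ∧ L₃ K y = 0) ∧ (∀ z, B₁ K y z = 0 ∧ B₂ K y z = 0 ∧ B₃ K y z = 0) ∧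
      ∀ z, B₁ K z y = 0 ∧ B₂ K z y = 0 ∧ B₃ K z y = 0 := by
  induction hy using Submodule.span_induction with
  | zero => simp
  | add y y' _ _ h h' => simp [h, h']
  | smul k y _ h => simp [h]
  | mem y hy =>
    obtain ⟨⟨i, j⟩, rfl⟩ := hy
    refine ⟨by simp [L₁_e, L₂_e, L₃_e, l₁, l₂, l₃], fun z => ?_, fun z => ?_⟩
    · exact ⟨eq_zero_of_apply_e (f := B₁ K _) (by simp [B₁_e, b₁]) z,
        eq_zero_of_apply_e (f := B₂ K _) (by simp [B₂_e, b₂]) z,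
        eq_zero_of_apply_e (f := B₃ K _) (by simp [B₃_e, b₃]) z⟩
    · exact ⟨eq_zero_of_apply_e (f := (B₁ K).flip _)
          (by rintro (i | i | ⟨i, j⟩) <;> simp [B₁_e, b₁]) z,
        eq_zero_of_apply_e (f := (B₂ K).flip _)
          (by rintro (i | i | ⟨i, j⟩) <;> simp [B₂_e, b₂]) z,
        eq_zero_of_apply_e (f := (B₃ K).flip _)
          (by rintro (i | i | ⟨i, j⟩) <;> simp [B₃_e, b₃]) z⟩

theorem e_s_mem (i j : ℕ) : e K (.s i j) ∈ sSpan K := Submodule.subset_span ⟨(i, j), rfl⟩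

theorem apply_mem_sSpan {f : (ModelIndex →₀ K) →ₗ[K] (ModelIndex →₀ K) →ₗ[K] ModelIndex →₀ K}
    (h : ∀ a b, f (e K a) (e K b) ∈ sSpan K) (y z : ModelIndex →₀ K) : f y z ∈ sSpan K := by
  induction y using Finsupp.induction_linear with
  | zero => simp
  | add y y' h h' => simpa using add_mem h h'
  | single a c =>
    induction z using Finsupp.induction_linear with
    | zero => simp
    | add z z' h h' => simpa using add_mem h h'
    | single b d =>
      have hs : ∀ (a : ModelIndex) (c : K), Finsupp.single a c = c • e K a := by simp [e]
      rw [hs, hs, map_smul, map_smul, LinearMap.smul_apply]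
      exact Submodule.smul_mem _ _ (Submodule.smul_mem _ _ (h a b))

theorem B₁_mem (y z : ModelIndex →₀ K) : B₁ K y z ∈ sSpan K := by
  refine apply_mem_sSpan ?_ y z
  rintro (i | i | ⟨i, j⟩) (i' | i' | ⟨i', j'⟩) <;>
    simp [B₁_e, b₁, e_s_mem, Submodule.smul_mem]

theorem B₂_mem (y z : ModelIndex →₀ K) : B₂ K y z ∈ sSpan K := by
  refine apply_mem_sSpan ?_ y z
  rintro (i | i | ⟨i, j⟩) (i' | i' | ⟨i', j'⟩) <;>
    simp [B₂_e, b₂, e_s_mem, Submodule.smul_mem, sub_mem]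

theorem B₃_mem (y z : ModelIndex →₀ K) : B₃ K y z ∈ sSpan K := by
  refine apply_mem_sSpan ?_ y z
  rintro (i | i | ⟨i, j⟩) (i' | i' | ⟨i', j'⟩) <;>
    simp [B₃_e, b₃, e_s_mem, Submodule.smul_mem]

end Model

/-! ### The product of the model -/

namespace Model

variable (K : Type u) [Field K]

/-- The component of degree greater than one of a product, as a linear function of the last
factor. -/
def upper (a b : K × (ModelIndex →₀ K)) : K × (ModelIndex →₀ K) →ₗ[K] ModelIndex →₀ K where
  toFun c := (a.1 * b.1 * c.1) • e K (.u 0) + (a.1 * b.1) • L₁ K c.2 + (a.1 * c.1) • L₂ K b.2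
    + (b.1 * c.1) • L₃ K a.2 + a.1 • B₁ K b.2 c.2 + b.1 • B₂ K a.2 c.2 + c.1 • B₃ K a.2 b.2
  map_add' c c' := by
    simp only [Prod.fst_add, Prod.snd_add, map_add]
    module
  map_smul' k c := by
    simp only [Prod.smul_fst, Prod.smul_snd, map_smul, RingHom.id_apply, smul_eq_mul]
    module

theorem upper_apply (a b c : K × (ModelIndex →₀ K)) : upper K a b c =
    (a.1 * b.1 * c.1) • e K (.u 0) + (a.1 * b.1) • L₁ K c.2 + (a.1 * c.1) • L₂ K b.2
      + (b.1 * c.1) • L₃ K a.2 + a.1 • B₁ K b.2 c.2 + b.1 • B₂ K a.2 c.2 + c.1 • B₃ K a.2 b.2 :=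
  rfl

/-- The product of the model: on `K × (ModelIndex →₀ K)`, with `x = (1, 0)`, it has the
components `L₁`, `L₂`, `L₃`, `B₁`, `B₂`, `B₃`, the cube of `x` is the basis vector `u 0`, and the
product of three elements of `0 × (ModelIndex →₀ K)` is zero. -/
def product : K × (ModelIndex →₀ K) →ₗ[K] K × (ModelIndex →₀ K) →ₗ[K] K × (ModelIndex →₀ K) →ₗ[K]
    K × (ModelIndex →₀ K) :=
  LinearMap.mk₂ K (fun a b => LinearMap.inr K K (ModelIndex →₀ K) ∘ₗ upper K a b)
    (fun a a' b => by
      rw [← LinearMap.comp_add]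
      congr 1
      refine LinearMap.ext fun c => ?_
      simp only [upper_apply, LinearMap.add_apply, Prod.fst_add, Prod.snd_add, map_add]
      module)
    (fun k a b => by
      rw [← LinearMap.comp_smul]
      congr 1
      refine LinearMap.ext fun c => ?_
      simp only [upper_apply, LinearMap.smul_apply, Prod.smul_fst, Prod.smul_snd, map_smul,
        smul_eq_mul]
      module)
    (fun a b b' => by
      rw [← LinearMap.comp_add]
      congr 1
      refine LinearMap.ext fun c => ?_
      simp only [upper_apply, LinearMap.add_apply, Prod.fst_add, Prod.snd_add, map_add]
      module)
    (fun k a b => by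
      rw [← LinearMap.comp_smul]
      congr 1
      refine LinearMap.ext fun c => ?_
      simp only [upper_apply, LinearMap.smul_apply, Prod.smul_fst, Prod.smul_snd, map_smul,
        smul_eq_mul]
      module)

theorem product_apply (a b c : K × (ModelIndex →₀ K)) : product K a b c =
    (0, (a.1 * b.1 * c.1) • e K (.u 0) + (a.1 * b.1) • L₁ K c.2 + (a.1 * c.1) • L₂ K b.2
      + (b.1 * c.1) • L₃ K a.2 + a.1 • B₁ K b.2 c.2 + b.1 • B₂ K a.2 c.2 + c.1 • B₃ K a.2 b.2) :=
  rfl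

theorem product_isPartiallyAssociative : IsPartiallyAssociative (product K) := by
  rintro ⟨k₁, y₁⟩ ⟨k₂, y₂⟩ ⟨k₃, y₃⟩ ⟨k₄, y₄⟩ ⟨k₅, y₅⟩
  have h₁ := fun y z : ModelIndex →₀ K => apply_eq_zero_of_mem_sSpan (B₁_mem y z)
  have h₂ := fun y z : ModelIndex →₀ K => apply_eq_zero_of_mem_sSpan (B₂_mem y z)
  have h₃ := fun y z : ModelIndex →₀ K => apply_eq_zero_of_mem_sSpan (B₃_mem y z)
  refine Prod.ext (by simp [product_apply]) ?_
  simp only [product_apply, Prod.snd_add, Prod.snd_zero, zero_mul, mul_zero, zero_smul, zero_add,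
    add_zero, map_add, map_smul, LinearMap.add_apply, LinearMap.smul_apply, h₁, h₂, h₃, smul_zero,
    B₁_L₁, B₃_L₁, B₁_apply_L₃, B₃_apply_L₃]
  -- The coefficient of each product of the `kᵢ` is one of the conditions on the six maps.
  linear_combination (norm := module) (k₁ * k₂ * k₃ * k₄ * k₅) • L_u_zero (K := K)
    + (k₂ * k₃ * k₄ * k₅) • B_apply_u_zero y₁ + (k₁ * k₃ * k₄ * k₅) • L₃_L₂ y₂
    + (k₁ * k₂ * k₄ * k₅) • L₃_L₁ y₃ + (k₁ * k₂ * k₃ * k₅) • L₂_L₁ y₄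
    + (k₁ * k₂ * k₃ * k₄) • L₁_L₁ y₅ + (k₂ * k₄ * k₅) • B₃_apply_L₂ y₁ y₃
    + (k₂ * k₃ * k₅) • B₃_L₃ y₁ y₄ + (k₂ * k₃ * k₄) • B₂_L₃ y₁ y₅
    + (k₁ * k₃ * k₅) • B₃_L₂ y₂ y₄ + (k₁ * k₃ * k₄) • B₂_L₂ y₂ y₅
    + (k₁ * k₂ * k₄) • B₂_L₁ y₃ y₅

end Model

/-! ### Normal forms as trees -/

namespace TernaryTree

section Evaluation

variable {K : Type u} [Field K] {A : Type w} [AddCommGroup A] [Module K A]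
  (μ : A →ₗ[K] A →ₗ[K] A →ₗ[K] A)

/-- The value of a tree whose leaves, from left to right, carry the elements `y 0`, `y 1`, … of a
ternary algebra; only the first `t.degree` terms of the sequence `y` are used. -/
def eval : TernaryTree → (ℕ → A) → A
  | .of _, y => y 0
  | .mul a b c, y => μ (eval a y) (eval b fun j => y (a.degree + j))
      (eval c fun j => y (a.degree + b.degree + j))

end Evaluation

/-- The tree of the element `NormalForm.u`. -/
def uTree : ℕ → TernaryTree
  | 0 => .of ()
  | i + 1 => .mul (.of ()) (uTree i) (.of ())

/-- The tree of the element `NormalForm.v`. -/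
def vTree (j : ℕ) : TernaryTree := .mul (.of ()) (.of ()) (uTree j)

/-- The tree of the element `NormalForm.s`. -/
def sTree (i j : ℕ) : TernaryTree := .mul (.of ()) (uTree i) (vTree j)

/-- The number of normal forms with `2 p + 1` leaves. -/
def normalCount (p : ℕ) : ℕ := if p ≤ 1 then 1 else if p = 2 then 2 else p + 1

/-- The normal forms with `2 p + 1` leaves, numbered by the `i < normalCount p`. The bound leaves
out `vTree 0 = uTree 1` and `sTree 0 0 = vTree 1`, which are listed already. -/
def normalTree (p : ℕ) : ℕ → TernaryTree
  | 0 => uTree p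
  | 1 => vTree (p - 1)
  | k + 2 => sTree k (p - 2 - k)

theorem degree_uTree (i : ℕ) : (uTree i).degree = 2 * i + 1 := by
  induction i with
  | zero => rfl
  | succ i ih => simp only [uTree, TernaryMonomial.degree, ih]; omega

theorem degree_normalTree {p i : ℕ} (hi : i < normalCount p) :
    (normalTree p i).degree = 2 * p + 1 := by
  rw [normalCount] at hi
  rcases i with _ | _ | k <;> simp only [normalTree, vTree, sTree, TernaryMonomial.degree,
    degree_uTree] <;> split_ifs at hi <;> omega

section NormalForms

variable {K : Type u} [Field K] {A : Type w} [AddCommGroup A] [Module K A]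
  (μ : A →ₗ[K] A →ₗ[K] A →ₗ[K] A) (x : A)

theorem eval_uTree (i : ℕ) : eval μ (uTree i) (fun _ => x) = NormalForm.u μ x i := by
  induction i with
  | zero => rfl
  | succ i ih => simp only [uTree, eval, NormalForm.u, ih]

theorem eval_vTree (j : ℕ) : eval μ (vTree j) (fun _ => x) = NormalForm.v μ x j := by
  simp only [vTree, eval, NormalForm.v, eval_uTree]

theorem eval_sTree (i j : ℕ) : eval μ (sTree i j) (fun _ => x) = NormalForm.s μ x i j := by
  simp only [sTree, eval, NormalForm.s, eval_uTree, eval_vTree]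

theorem level_le_span (p : ℕ) : NormalForm.level μ x p ≤ Submodule.span K
    (Set.range fun i : Fin (normalCount p) => eval μ (normalTree p i) fun _ => x) := by
  have key : ∀ i, i < normalCount p → ∀ z, z = eval μ (normalTree p i) (fun _ => x) →
      z ∈ Submodule.span K
        (Set.range fun i : Fin (normalCount p) => eval μ (normalTree p i) fun _ => x) :=
    fun i hi z hz => Submodule.subset_span ⟨⟨i, hi⟩, hz.symm⟩
  refine Submodule.span_le.2 ?_
  rintro z (rfl | ⟨j, rfl, rfl⟩ | ⟨i, j, rfl, rfl⟩)
  · refine key 0 ?_ _ (eval_uTree μ x p).symm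
    rw [normalCount]
    split_ifs <;> omega
  · rcases j with _ | j
    · exact key 0 (by simp [normalCount]) _ (eval_uTree μ x 1).symm
    · refine key 1 ?_ _ (eval_vTree μ x (j + 1)).symm
      rw [normalCount]
      split_ifs <;> omega
  · by_cases hij : i + j = 0
    · obtain ⟨rfl, rfl⟩ : i = 0 ∧ j = 0 := by omega
      exact key 1 (by simp [normalCount]) _ (eval_vTree μ x 1).symm
    · refine key (i + 2) ?_ _ ?_
      · rw [normalCount]
        split_ifs <;> omega
      · rw [normalTree, eval_sTree]
        congr 1
        omega

variable {μ} in
theorem eval_mem_level [CharZero K] (hμ : IsPartiallyAssociative μ) (t : TernaryTree) :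
    ∃ p, t.degree = 2 * p + 1 ∧ eval μ t (fun _ => x) ∈ NormalForm.level μ x p := by
  induction t with
  | of _ => exact ⟨0, rfl, NormalForm.u_mem_level μ x rfl⟩
  | mul a b c ha hb hc =>
    obtain ⟨p, hp, ha⟩ := ha
    obtain ⟨q, hq, hb⟩ := hb
    obtain ⟨r, hr, hc⟩ := hc
    refine ⟨p + q + r + 1, ?_, NormalForm.mul_mem_level hμ x ha hb hc⟩
    rw [TernaryMonomial.degree, hp, hq, hr]
    omega

variable {μ} in
/-- In a partially associative algebra, the powers of an element that are given by trees with
`2 p + 1` leaves are linear combinations of those given by normal forms. -/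
theorem eval_mem_span_normalTree [CharZero K] (hμ : IsPartiallyAssociative μ) {t : TernaryTree}
    {p : ℕ} (ht : t.degree = 2 * p + 1) : eval μ t (fun _ => x) ∈ Submodule.span K
      (Set.range fun i : Fin (normalCount p) => eval μ (normalTree p i) fun _ => x) := by
  obtain ⟨q, hq, h⟩ := eval_mem_level x hμ t
  obtain rfl : q = p := by omega
  exact level_le_span μ x q h

end NormalForms

end TernaryTree

namespace Model

variable (K : Type u) [Field K]

open NormalForm

/-- The generator of the model. -/
def gen : K × (ModelIndex →₀ K) := (1, 0)

theorem u_succ (i : ℕ) : u (product K) (gen K) (i + 1) = (0, e K (.u i)) := by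
  induction i with
  | zero => simp [u, gen, product_apply]
  | succ i ih =>
    rw [u, ih]
    simp [gen, product_apply, L₂_e, l₂]

theorem v_zero : NormalForm.v (product K) (gen K) 0 = (0, e K (.u 0)) := u_succ K 0

theorem v_succ (i : ℕ) : NormalForm.v (product K) (gen K) (i + 1) = (0, e K (.v i)) := by
  rw [NormalForm.v, u_succ]
  simp [gen, product_apply, L₁_e, l₁]

theorem s_zero_succ (j : ℕ) : s (product K) (gen K) 0 (j + 1) = (0, e K (.s 0 (j + 1))) := by
  rw [s, v_succ, u]
  simp [gen, product_apply, L₁_e, l₁]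

theorem s_succ (i j : ℕ) : s (product K) (gen K) (i + 1) j = (0, e K (.s (i + 1) j)) := by
  rw [s, u_succ]
  cases j with
  | zero =>
    rw [v_zero]
    simp [gen, product_apply, B₁_e, b₁]
  | succ j =>
    rw [v_succ]
    simp [gen, product_apply, B₁_e, b₁]

/-- The index of the basis vector that is the value of a normal form. -/
def normalIndex (p : ℕ) : ℕ → ModelIndex
  | 0 => .u (p - 1)
  | 1 => .v (p - 2)
  | k + 2 => .s k (p - 2 - k)

theorem normalIndex_injective (p : ℕ) : Function.Injective (normalIndex p) := by
  rintro (_ | _ | i) (_ | _ | j) h <;> simp_all [normalIndex]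

theorem eval_normalTree {p i : ℕ} (hp : p ≠ 0) (hi : i < TernaryTree.normalCount p) :
    TernaryTree.eval (product K) (TernaryTree.normalTree p i) (fun _ => gen K)
      = (0, e K (normalIndex p i)) := by
  obtain ⟨p, rfl⟩ := Nat.exists_eq_succ_of_ne_zero hp
  rw [TernaryTree.normalCount] at hi
  rcases i with _ | _ | k
  · exact (TernaryTree.eval_uTree _ _ _).trans (u_succ K p)
  · obtain ⟨p, rfl⟩ : ∃ q, p = q + 1 := Nat.exists_eq_succ_of_ne_zero (by
      rintro rfl
      simp at hi)
    exact (TernaryTree.eval_vTree _ _ _).trans (v_succ K p)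
  · refine (TernaryTree.eval_sTree _ _ _ _).trans ?_
    rw [normalIndex]
    rcases k with _ | k
    · obtain ⟨q, hq⟩ : ∃ q, p + 1 - 2 - 0 = q + 1 := Nat.exists_eq_succ_of_ne_zero (by
        split_ifs at hi <;> omega)
      rw [Nat.succ_eq_add_one, hq]
      exact s_zero_succ K q
    · exact s_succ K k _

/-- The values of the normal forms at the generator of the model are linearly independent. -/
theorem linearIndependent_eval (p : ℕ) : LinearIndependent K
    fun i : Fin (TernaryTree.normalCount p) =>
      TernaryTree.eval (product K) (TernaryTree.normalTree p i) fun _ => gen K := by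
  by_cases hp : p = 0
  · subst hp
    have : Subsingleton (Fin (TernaryTree.normalCount 0)) := inferInstanceAs (Subsingleton (Fin 1))
    refine LinearIndependent.of_subsingleton (⟨0, Nat.one_pos⟩ : Fin 1) fun h => ?_
    exact one_ne_zero (congrArg Prod.fst h : (1 : K) = 0)
  · have h : LinearIndependent K fun i : Fin (TernaryTree.normalCount p) =>
        e K (normalIndex p i) :=
      (Finsupp.linearIndependent_single_one K ModelIndex).comp _
        ((normalIndex_injective p).comp Fin.val_injective)
    have h' : LinearIndependent K fun i : Fin (TernaryTree.normalCount p) =>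
        ((0, e K (normalIndex p i)) : K × (ModelIndex →₀ K)) :=
      h.map' (LinearMap.inr K K (ModelIndex →₀ K)) (LinearMap.ker_eq_bot.2 LinearMap.inr_injective)
    rwa [← funext fun i : Fin (TernaryTree.normalCount p) => eval_normalTree K hp i.2] at h'

end Model

/-! ### Evaluation of trees and operadic composition -/

namespace TernaryTree

theorem degree_pos (t : TernaryTree) : 0 < t.degree := by
  cases t with
  | of _ => exact Nat.one_pos
  | mul a b c =>
    have := degree_pos a
    rw [TernaryMonomial.degree]
    omega

theorem degree_graft (t : TernaryTree) {i : ℕ} (hi : i < t.degree) (s : TernaryTree) :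
    (graft t i s).degree + 1 = t.degree + s.degree := by
  induction t generalizing i with
  | of _ => rw [graft, TernaryMonomial.degree, add_comm]
  | mul a b c ha hb hc =>
    rw [TernaryMonomial.degree] at hi
    rw [graft]
    split_ifs with h₁ h₂
    · have := ha h₁
      simp only [TernaryMonomial.degree]
      omega
    · have := hb (i := i - a.degree) (by omega)
      simp only [TernaryMonomial.degree]
      omega
    · have := hc (i := i - (a.degree + b.degree)) (by omega)
      simp only [TernaryMonomial.degree]
      omega

variable {K : Type u} [Field K] {A : Type w} [AddCommGroup A] [Module K A]
  (μ : A →ₗ[K] A →ₗ[K] A →ₗ[K] A)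

theorem eval_congr (t : TernaryTree) {y z : ℕ → A} (h : ∀ j < t.degree, y j = z j) :
    eval μ t y = eval μ t z := by
  induction t generalizing y z with
  | of _ => exact h 0 Nat.one_pos
  | mul a b c ha hb hc =>
    rw [TernaryMonomial.degree] at h
    rw [eval, eval, ha fun j hj => h j (by omega), hb fun j hj => h _ (by omega),
      hc fun j hj => h _ (by omega)]

/-- Grafting `s` on the leaf `i` amounts to putting the value of `s` on that leaf. -/
theorem eval_graft (t : TernaryTree) {i : ℕ} (hi : i < t.degree) (s : TernaryTree) (y : ℕ → A) :
    eval μ (graft t i s) y = eval μ t (Function.update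
      (fun j => if j < i then y j else y (j + s.degree - 1)) i (eval μ s fun k => y (i + k))) := by
  have hs := degree_pos s
  induction t generalizing i y with
  | of _ =>
    obtain rfl : i = 0 := by
      rw [TernaryMonomial.degree] at hi
      omega
    simp [graft, eval]
  | mul a b c ha hb hc =>
    rw [TernaryMonomial.degree] at hi
    rw [graft]
    split_ifs with h₁ h₂
    · have hd := degree_graft a h₁ s
      rw [eval, eval, ha h₁]
      congr 1
      · congr 1
        refine eval_congr μ b fun j hj => ?_
        rw [Function.update_of_ne (by omega), if_neg (by omega)]
        congr 1
        omega
      · refine eval_congr μ c fun j hj => ?_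
        rw [Function.update_of_ne (by omega), if_neg (by omega)]
        congr 1
        omega
    · have hi' : i - a.degree < b.degree := by omega
      have hd := degree_graft b hi' s
      rw [eval, eval, hb hi']
      congr 1
      · congr 1
        · congr 1
          refine eval_congr μ a fun j hj => ?_
          rw [Function.update_of_ne (by omega), if_pos (by omega)]
        · refine eval_congr μ b fun j hj => ?_
          by_cases hj' : j = i - a.degree
          · rw [← hj', show i = a.degree + j by omega, Function.update_self, Function.update_self]
            simp only [add_assoc]
          · rw [Function.update_of_ne hj', Function.update_of_ne (by omega)]
            split_ifs <;> first | rfl | omega | (congr 1; omega)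
      · refine eval_congr μ c fun j hj => ?_
        rw [Function.update_of_ne (by omega), if_neg (by omega)]
        congr 1
        omega
    · have hi' : i - (a.degree + b.degree) < c.degree := by omega
      rw [eval, eval, hc hi']
      congr 1
      · congr 1
        · congr 1
          refine eval_congr μ a fun j hj => ?_
          rw [Function.update_of_ne (by omega), if_pos (by omega)]
        · refine eval_congr μ b fun j hj => ?_
          rw [Function.update_of_ne (by omega), if_pos (by omega)]
      · refine eval_congr μ c fun j hj => ?_
        by_cases hj' : j = i - (a.degree + b.degree)
        · rw [← hj', show i = a.degree + b.degree + j by omega, Function.update_self,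
            Function.update_self]
          simp only [add_assoc]
        · rw [Function.update_of_ne hj', Function.update_of_ne (by omega)]
          split_ifs <;> first | rfl | omega | (congr 1; omega)

/-- The value of a tree depends linearly on the element put on a given leaf. -/
theorem exists_eval_update (t : TernaryTree) {i : ℕ} (hi : i < t.degree) (y : ℕ → A) :
    ∃ φ : A →ₗ[K] A, ∀ z, eval μ t (Function.update y i z) = φ z := by
  induction t generalizing i y with
  | of _ =>
    obtain rfl : i = 0 := by
      rw [TernaryMonomial.degree] at hi
      omega
    exact ⟨LinearMap.id, fun z => by simp [eval]⟩
  | mul a b c ha hb hc =>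
    rw [TernaryMonomial.degree] at hi
    have hb₀ : ∀ z, (i < a.degree ∨ a.degree + b.degree ≤ i) →
        eval μ b (fun j => Function.update y i z (a.degree + j))
          = eval μ b fun j => y (a.degree + j) := fun z h =>
      eval_congr μ b fun j hj => Function.update_of_ne (by omega) _ _
    have hc₀ : ∀ z, i < a.degree + b.degree →
        eval μ c (fun j => Function.update y i z (a.degree + b.degree + j))
          = eval μ c fun j => y (a.degree + b.degree + j) := fun z h =>
      eval_congr μ c fun j hj => Function.update_of_ne (by omega) _ _
    have ha₀ : ∀ z, a.degree ≤ i → eval μ a (Function.update y i z) = eval μ a y := fun z h =>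
      eval_congr μ a fun j hj => Function.update_of_ne (by omega) _ _
    have shift : ∀ z d, d ≤ i → (fun j => Function.update y i z (d + j))
        = Function.update (fun j => y (d + j)) (i - d) z := by
      intro z d h
      ext1 j
      by_cases hj : j = i - d
      · rw [show d + j = i by omega, hj]
        simp
      · rw [Function.update_of_ne hj, Function.update_of_ne (by omega)]
    by_cases h₁ : i < a.degree
    · obtain ⟨φ, hφ⟩ := ha h₁ y
      refine ⟨((μ.flip (eval μ b fun j => y (a.degree + j))).flip
        (eval μ c fun j => y (a.degree + b.degree + j))) ∘ₗ φ, fun z => ?_⟩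
      rw [eval, hφ, hb₀ z (Or.inl h₁), hc₀ z (by omega)]
      rfl
    · by_cases h₂ : i < a.degree + b.degree
      · obtain ⟨φ, hφ⟩ := hb (i := i - a.degree) (by omega) fun j => y (a.degree + j)
        refine ⟨((μ (eval μ a y)).flip (eval μ c fun j => y (a.degree + b.degree + j))) ∘ₗ φ,
          fun z => ?_⟩
        rw [eval, ha₀ z (by omega), hc₀ z h₂, shift z a.degree (by omega), hφ]
        rfl
      · obtain ⟨φ, hφ⟩ := hc (i := i - (a.degree + b.degree)) (by omega)
          fun j => y (a.degree + b.degree + j)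
        refine ⟨μ (eval μ a y) (eval μ b fun j => y (a.degree + j)) ∘ₗ φ, fun z => ?_⟩
        rw [eval, ha₀ z (by omega), hb₀ z (by omega), shift z (a.degree + b.degree) (by omega), hφ]
        rfl

/-- The linear extension of the evaluation of the trees with `m` leaves; all other trees are sent
to zero. -/
def evalPoly (m : ℕ) (y : ℕ → A) : TernaryPolynomial K Unit →ₗ[K] A :=
  Finsupp.linearCombination K fun t : TernaryTree => if t.degree = m then eval μ t y else 0

theorem evalPoly_monomial (m : ℕ) (y : ℕ → A) (t : TernaryTree) :
    evalPoly μ m y (TernaryPolynomial.monomial K t) = if t.degree = m then eval μ t y else 0 := by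
  simp [evalPoly, TernaryPolynomial.monomial]

end TernaryTree

namespace PartiallyAssociativeOperad

open TernaryPolynomial TernaryTree

variable {K : Type u} [Field K]

theorem hom_ext {M : Type*} [AddCommGroup M] [Module K M] {X : Type v}
    {f g : TernaryPolynomial K X →ₗ[K] M} (h : ∀ t, f (monomial K t) = g (monomial K t)) : f = g :=
  Finsupp.lhom_ext' fun t => LinearMap.ext_ring (h t)

theorem circ_monomial (i : ℕ) (t s : TernaryTree) :
    circ K i (monomial K t) (monomial K s) =
      if i < t.degree then monomial K (graft t i s) else 0 := by
  simp [circ, monomial]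

variable {A : Type w} [AddCommGroup A] [Module K A] {μ : A →ₗ[K] A →ₗ[K] A →ₗ[K] A}

/-- Evaluation in a partially associative algebra kills the ideal of relations of the operad,
arity by arity. -/
theorem evalPoly_eq_zero (hμ : IsPartiallyAssociative μ) {f : TernaryPolynomial K Unit}
    (hf : f ∈ operadicIdeal K) (m : ℕ) (y : ℕ → A) : evalPoly μ m y f = 0 := by
  let I : Submodule K (TernaryPolynomial K Unit) := ⨅ (m : ℕ) (y : ℕ → A), (evalPoly μ m y).ker
  have hI : ∀ {f}, f ∈ I ↔ ∀ m y, evalPoly μ m y f = 0 := by simp [I]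
  refine hI.1 ((sInf_le ?_ : operadicIdeal K ≤ I) hf) m y
  refine ⟨hI.2 fun m y => ?_, fun f hf g i => ⟨?_, ?_⟩⟩
  · have h := hμ (y 0) (y 1) (y 2) (y 3) (y 4)
    simp only [relator, Finset.sum_range_succ, Finset.sum_range_zero, circ_monomial, corolla,
      TernaryMonomial.degree, graft, zero_add, map_add]
    by_cases hm : 5 = m
    · simpa [evalPoly_monomial, TernaryMonomial.degree, eval, hm] using h
    · simp [evalPoly_monomial, TernaryMonomial.degree, hm]
  · induction g using Finsupp.induction_linear with
    | zero => simp
    | add g g' h h' => simpa using add_mem h h'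
    | single s c =>
      rw [show Finsupp.single s c = c • monomial K s by simp [monomial], map_smul]
      refine Submodule.smul_mem _ _ (hI.2 fun m y => ?_)
      -- Composites of arity `m` come from the trees with `m + 1 - s.degree` leaves; the test
      -- `i < m + 1 - s.degree` also covers the case where the subtraction is truncated.
      have key : evalPoly μ m y ∘ₗ (circ K i).flip (monomial K s)
          = if i < m + 1 - s.degree then evalPoly μ (m + 1 - s.degree) (Function.update
            (fun j => if j < i then y j else y (j + s.degree - 1)) i (eval μ s fun k => y (i + k)))
            else 0 := by
        refine hom_ext fun t => ?_
        have ht := degree_pos t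
        have hs := degree_pos s
        rw [LinearMap.comp_apply, LinearMap.flip_apply, circ_monomial]
        by_cases hit : i < t.degree
        · have hd := degree_graft t hit s
          rw [if_pos hit, evalPoly_monomial]
          by_cases hm : t.degree = m + 1 - s.degree
          · rw [if_pos (by omega), if_pos (by omega), evalPoly_monomial, if_pos hm,
              eval_graft μ t hit]
          · rw [if_neg (by omega)]
            split_ifs
            · rw [evalPoly_monomial, if_neg hm]
            · rfl
        · rw [if_neg hit, map_zero]
          split_ifs
          · rw [evalPoly_monomial, if_neg (by omega)]
          · rfl
      have h := LinearMap.congr_fun key f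
      rw [LinearMap.comp_apply, LinearMap.flip_apply] at h
      rw [h]
      split_ifs
      · exact hI.1 hf _ _
      · rfl
  · induction g using Finsupp.induction_linear with
    | zero => simp
    | add g g' h h' => simpa using add_mem h h'
    | single t c =>
      rw [show Finsupp.single t c = c • monomial K t by simp [monomial], map_smul,
        LinearMap.smul_apply]
      refine Submodule.smul_mem _ _ (hI.2 fun m y => ?_)
      by_cases hit : i < t.degree
      · obtain ⟨φ, hφ⟩ := exists_eval_update μ t hit
          fun j => if j < i then y j else y (j + (m + 1 - t.degree) - 1)
        have key : evalPoly μ m y ∘ₗ circ K i (monomial K t)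
            = φ ∘ₗ evalPoly μ (m + 1 - t.degree) fun k => y (i + k) := by
          refine hom_ext fun s => ?_
          have hs := degree_pos s
          have hd := degree_graft t hit s
          rw [LinearMap.comp_apply, LinearMap.comp_apply, circ_monomial, if_pos hit,
            evalPoly_monomial, evalPoly_monomial]
          by_cases hm : s.degree = m + 1 - t.degree
          · rw [if_pos (by omega), if_pos hm, eval_graft μ t hit, hm, hφ]
          · rw [if_neg (by omega), if_neg hm, map_zero]
        have h := LinearMap.congr_fun key f
        rw [LinearMap.comp_apply, LinearMap.comp_apply, hI.1 hf, map_zero] at h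
        exact h
      · have key : circ K i (monomial K t) = 0 := hom_ext fun s => by
          rw [circ_monomial, if_neg hit, LinearMap.zero_apply]
        simp [key]

end PartiallyAssociativeOperad

/-! ### The components of the operad -/

namespace IsPartiallyAssociative

variable {K : Type u} [Field K] {A : Type w} [AddCommGroup A] [Module K A]
  {μ : A →ₗ[K] A →ₗ[K] A →ₗ[K] A}

/-- Partial associativity is a multilinear condition, so it may be checked on a spanning set. -/
theorem of_span_eq_top {S : Set A} (hS : Submodule.span K S = ⊤)
    (h : ∀ a ∈ S, ∀ b ∈ S, ∀ c ∈ S, ∀ d ∈ S, ∀ e ∈ S,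
      μ (μ a b c) d e + μ a (μ b c d) e + μ a b (μ c d e) = 0) : IsPartiallyAssociative μ := by
  have hmem : ∀ z, z ∈ Submodule.span K S := fun z => hS ▸ Submodule.mem_top
  intro a b c d e
  induction hmem a using Submodule.span_induction with
  | zero => simp
  | add z z' _ _ h h' =>
    simp only [map_add, LinearMap.add_apply]
    linear_combination (norm := module) h + h'
  | smul k z _ h =>
    simp only [map_smul, LinearMap.smul_apply]
    linear_combination (norm := module) k • h
  | mem a ha =>
  induction hmem b using Submodule.span_induction with
  | zero => simp
  | add z z' _ _ h h' =>
    simp only [map_add, LinearMap.add_apply]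
    linear_combination (norm := module) h + h'
  | smul k z _ h =>
    simp only [map_smul, LinearMap.smul_apply]
    linear_combination (norm := module) k • h
  | mem b hb =>
  induction hmem c using Submodule.span_induction with
  | zero => simp
  | add z z' _ _ h h' =>
    simp only [map_add, LinearMap.add_apply]
    linear_combination (norm := module) h + h'
  | smul k z _ h =>
    simp only [map_smul, LinearMap.smul_apply]
    linear_combination (norm := module) k • h
  | mem c hc =>
  induction hmem d using Submodule.span_induction with
  | zero => simp
  | add z z' _ _ h h' =>
    simp only [map_add, LinearMap.add_apply]
    linear_combination (norm := module) h + h'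
  | smul k z _ h =>
    simp only [map_smul, LinearMap.smul_apply]
    linear_combination (norm := module) k • h
  | mem d hd =>
  induction hmem e using Submodule.span_induction with
  | zero => simp
  | add z z' _ _ h h' =>
    simp only [map_add]
    linear_combination (norm := module) h + h'
  | smul k z _ h =>
    simp only [map_smul]
    linear_combination (norm := module) k • h
  | mem e he => exact h a ha b hb c hc d hd e he

end IsPartiallyAssociative

namespace PartiallyAssociativeOperad

open TernaryPolynomial TernaryTree

variable (K : Type u) [Field K]

theorem mul_monomial {X : Type v} (r s t : TernaryMonomial X) :
    mul K (monomial K r) (monomial K s) (monomial K t) = monomial K (.mul r s t) := by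
  simp [mul, monomial]

/-- The product of the free ternary algebra is a composition with the corolla, filled from right
to left so that the numbering of the inputs still free does not change. -/
theorem mul_eq_circ (a b c : TernaryPolynomial K Unit) : mul K a b c
    = circ K 0 (circ K 1 (circ K 2 (monomial K corolla) c) b) a := by
  induction a using Finsupp.induction_linear with
  | zero => simp
  | add a a' h h' => simp only [map_add, LinearMap.add_apply, h, h']
  | single r k =>
  induction b using Finsupp.induction_linear with
  | zero => simp
  | add b b' h h' => simp only [map_add, LinearMap.add_apply, h, h']
  | single s l =>
  induction c using Finsupp.induction_linear with
  | zero => simp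
  | add c c' h h' => simp only [map_add, LinearMap.add_apply, h, h']
  | single t m =>
    have hs : ∀ (t : TernaryTree) (c : K), Finsupp.single t c = c • monomial K t := by
      simp [monomial]
    simp only [hs, map_smul, LinearMap.smul_apply, mul_monomial, corolla, circ_monomial,
      TernaryMonomial.degree, graft]
    norm_num [circ_monomial, graft, TernaryMonomial.degree, Nat.lt_add_right]
    module

theorem circ_mem_left {f : TernaryPolynomial K Unit} (hf : f ∈ operadicIdeal K) (i : ℕ)
    (g : TernaryPolynomial K Unit) : circ K i f g ∈ operadicIdeal K := by
  simp only [operadicIdeal, Submodule.mem_sInf] at hf ⊢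
  exact fun I hI => (hI.2 f (hf I hI) g i).1

theorem circ_mem_right {f : TernaryPolynomial K Unit} (hf : f ∈ operadicIdeal K) (i : ℕ)
    (g : TernaryPolynomial K Unit) : circ K i g f ∈ operadicIdeal K := by
  simp only [operadicIdeal, Submodule.mem_sInf] at hf ⊢
  exact fun I hI => (hI.2 f (hf I hI) g i).2

theorem relator_mem : relator K ∈ operadicIdeal K := by
  simp only [operadicIdeal, Submodule.mem_sInf]
  exact fun I hI => hI.1

theorem operadicIdeal_isTernaryIdeal : IsTernaryIdeal (mul K) (operadicIdeal K) := by
  intro x hx a b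
  simp only [mul_eq_circ]
  exact ⟨circ_mem_right K hx _ _, circ_mem_left K (circ_mem_right K hx _ _) _ _,
    circ_mem_left K (circ_mem_left K (circ_mem_right K hx _ _) _ _) _ _⟩

/-- The quotient of the tree space by the operadic ideal, as a ternary algebra. It is the free
partially associative algebra on one generator. -/
abbrev quotientMul : TernaryPolynomial K Unit ⧸ operadicIdeal K →ₗ[K]
    TernaryPolynomial K Unit ⧸ operadicIdeal K →ₗ[K]
    TernaryPolynomial K Unit ⧸ operadicIdeal K →ₗ[K] TernaryPolynomial K Unit ⧸ operadicIdeal K :=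
  quotientProduct (mul K) (operadicIdeal K) (operadicIdeal_isTernaryIdeal K)

theorem span_range_mkQ_monomial :
    Submodule.span K (Set.range fun t => (operadicIdeal K).mkQ (monomial K t)) = ⊤ := by
  have h : Submodule.span K (Set.range fun t : TernaryTree => monomial K t) = ⊤ :=
    (Finsupp.basisSingleOne (R := K)).span_eq
  rw [← Submodule.range_mkQ, LinearMap.range_eq_map, ← h, Submodule.map_span, ← Set.range_comp]
  rfl

theorem quotientMul_isPartiallyAssociative : IsPartiallyAssociative (quotientMul K) := by
  refine .of_span_eq_top (span_range_mkQ_monomial K) ?_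
  rintro _ ⟨a, rfl⟩ _ ⟨b, rfl⟩ _ ⟨c, rfl⟩ _ ⟨d, rfl⟩ _ ⟨e, rfl⟩
  simp only [quotientProduct_mk, mul_monomial, ← map_add]
  refine (Submodule.Quotient.mk_eq_zero _).2 ?_
  -- The relator has five inputs, which are filled from right to left.
  have h := circ_mem_left K (circ_mem_left K (circ_mem_left K (circ_mem_left K (circ_mem_left K
    (relator_mem K) 4 (monomial K e)) 3 (monomial K d)) 2 (monomial K c)) 1 (monomial K b)) 0
    (monomial K a)
  simp only [relator, Finset.sum_range_succ, Finset.sum_range_zero, corolla, zero_add, map_add,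
    LinearMap.add_apply] at h
  have h₁ : ∀ i j k, 1 < 2 + i + j + k := by omega
  norm_num [circ_monomial, graft, TernaryMonomial.degree, ← add_assoc, Nat.lt_add_right, h₁] at h
  exact h

/-- Each tree is, in the quotient, its own value at the tree with one leaf. -/
theorem eval_quotientMul (t : TernaryTree) :
    eval (quotientMul K) t (fun _ => (operadicIdeal K).mkQ (monomial K (.of ())))
      = (operadicIdeal K).mkQ (monomial K t) := by
  induction t with
  | of _ => rfl
  | mul a b c ha hb hc => rw [eval, ha, hb, hc, quotientProduct_mk, mul_monomial]

theorem component_eq_span [CharZero K] (p : ℕ) : component K (2 * p + 1) = Submodule.span K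
    (Set.range fun i : Fin (normalCount p) =>
      (operadicIdeal K).mkQ (monomial K (normalTree p i))) := by
  rw [component, homogeneous, Submodule.map_span, ← Set.image_comp]
  refine le_antisymm (Submodule.span_le.2 ?_) (Submodule.span_mono ?_)
  · rintro _ ⟨t, ht, rfl⟩
    have h := eval_mem_span_normalTree ((operadicIdeal K).mkQ (monomial K (.of ())))
      (quotientMul_isPartiallyAssociative K) ht
    simp only [eval_quotientMul] at h
    exact h
  · rintro _ ⟨i, rfl⟩
    exact ⟨normalTree p i, degree_normalTree i.2, rfl⟩

theorem linearIndependent_normalTree (p : ℕ) : LinearIndependent K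
    fun i : Fin (normalCount p) => (operadicIdeal K).mkQ (monomial K (normalTree p i)) := by
  refine LinearIndependent.of_comp ((operadicIdeal K).liftQ
    (evalPoly (Model.product K) (2 * p + 1) fun _ => Model.gen K) fun f hf =>
      evalPoly_eq_zero (Model.product_isPartiallyAssociative K) hf _ _) ?_
  have h := Model.linearIndependent_eval K p
  have h' : ∀ i : Fin (normalCount p), evalPoly (Model.product K) (2 * p + 1)
      (fun _ => Model.gen K) (monomial K (normalTree p i))
        = eval (Model.product K) (normalTree p i) fun _ => Model.gen K := fun i => by
    rw [evalPoly_monomial, if_pos (degree_normalTree i.2)]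
  rwa [← funext h'] at h

theorem rank_component [CharZero K] (p : ℕ) :
    Module.rank K (component K (2 * p + 1)) = (normalCount p : Cardinal) := by
  have h := linearIndependent_normalTree K p
  have hr := rank_span h
  rw [component_eq_span, hr]
  have := Cardinal.mk_range_eq_of_injective h.injective
  simpa using this

end PartiallyAssociativeOperad

/-! ### Words in several letters -/

namespace TernaryTree

variable {K : Type u} [Field K] {A : Type w} [AddCommGroup A] [Module K A]
  (μ : A →ₗ[K] A →ₗ[K] A →ₗ[K] A)

/-- The concatenation of the first `d` terms of `y`, the first `e` terms of `z`, and `w`. -/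
def glue {X : Type*} (d e : ℕ) (y z w : ℕ → X) (j : ℕ) : X :=
  if j < d then y j else if j < d + e then z (j - d) else w (j - (d + e))

theorem eval_mul_glue {X : Type*} (f : X → A) (a b c : TernaryTree) (y z w : ℕ → X) :
    eval μ (.mul a b c) (fun j => f (glue a.degree b.degree y z w j))
      = μ (eval μ a fun j => f (y j)) (eval μ b fun j => f (z j)) (eval μ c fun j => f (w j)) := by
  rw [eval]
  congr 1
  · congr 1
    · congr 1
      refine eval_congr μ a fun j hj => ?_
      rw [glue, if_pos hj]
    · refine eval_congr μ b fun j hj => ?_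
      rw [glue, if_neg (by omega), if_pos (by omega), Nat.add_sub_cancel_left]
  · refine eval_congr μ c fun j hj => ?_
    rw [glue, if_neg (by omega), if_neg (by omega), Nat.add_sub_cancel_left]

/-- Multilinear expansion of the value of a tree. -/
theorem eval_mem_span_eval {X : Type*} (f : X → A) (t : TernaryTree) (y : ℕ → A)
    (hy : ∀ j, y j ∈ Submodule.span K (Set.range f)) :
    eval μ t y ∈ Submodule.span K (Set.range fun w : ℕ → X => eval μ t fun j => f (w j)) := by
  induction t generalizing y with
  | of _ =>
    refine Submodule.span_mono ?_ (hy 0)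
    rintro _ ⟨i, rfl⟩
    exact ⟨fun _ => i, rfl⟩
  | mul a b c ha hb hc =>
    rw [eval]
    have ha := ha y hy
    have hb := hb (fun j => y (a.degree + j)) fun j => hy _
    have hc := hc (fun j => y (a.degree + b.degree + j)) fun j => hy _
    generalize eval μ a y = α at ha ⊢
    generalize eval μ b (fun j => y (a.degree + j)) = β at hb ⊢
    generalize eval μ c (fun j => y (a.degree + b.degree + j)) = γ at hc ⊢
    induction ha using Submodule.span_induction with
    | zero => simp
    | add z z' _ _ h h' => simpa using add_mem h h'
    | smul k z _ h => simpa using Submodule.smul_mem _ k h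
    | mem z hz =>
    induction hb using Submodule.span_induction with
    | zero => simp
    | add z z' _ _ h h' => simpa using add_mem h h'
    | smul k z _ h => simpa using Submodule.smul_mem _ k h
    | mem z' hz' =>
    induction hc using Submodule.span_induction with
    | zero => simp
    | add z z' _ _ h h' => simpa using add_mem h h'
    | smul k z _ h => simpa using Submodule.smul_mem _ k h
    | mem z'' hz'' =>
      obtain ⟨p, rfl⟩ := hz
      obtain ⟨q, rfl⟩ := hz'
      obtain ⟨r, rfl⟩ := hz''
      exact Submodule.subset_span ⟨glue a.degree b.degree p q r, eval_mul_glue μ f a b c p q r⟩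

theorem eval_map {B : Type*} [AddCommGroup B] [Module K B] (ν : B →ₗ[K] B →ₗ[K] B →ₗ[K] B)
    (F : A →ₗ[K] B) (hF : ∀ x y z, F (μ x y z) = ν (F x) (F y) (F z)) (t : TernaryTree)
    (y : ℕ → A) : F (eval μ t y) = eval ν t fun j => F (y j) := by
  induction t generalizing y with
  | of _ => rfl
  | mul a b c ha hb hc => rw [eval, hF, ha, hb, hc, eval]

end TernaryTree

/-! ### Tensor products with associative algebras -/

section TensorProduct

open scoped TensorProduct

variable {K : Type u} [Field K] {A : Type w} [AddCommGroup A] [Module K A]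
  (μ : A →ₗ[K] A →ₗ[K] A →ₗ[K] A) (R : Type v) [Ring R] [Algebra K R]

/-- The product `(a ⊗ r, b ⊗ s, c ⊗ t) ↦ μ(a, b, c) ⊗ r s t` on the tensor product of a ternary
algebra and an associative algebra. -/
def tensorProduct : A ⊗[K] R →ₗ[K] A ⊗[K] R →ₗ[K] A ⊗[K] R →ₗ[K] A ⊗[K] R :=
  (TensorProduct.map₂ μ ((LinearMap.mul K R).compr₂ (LinearMap.mul K R))).compr₂
    (TensorProduct.homTensorHomMap (RingHom.id K) A R A R)

theorem tensorProduct_tmul (a b c : A) (r s t : R) :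
    tensorProduct μ R (a ⊗ₜ r) (b ⊗ₜ s) (c ⊗ₜ t) = μ a b c ⊗ₜ (r * s * t) := rfl

variable {μ}

theorem tensorProduct_isPartiallyAssociative (hμ : IsPartiallyAssociative μ) :
    IsPartiallyAssociative (tensorProduct μ R) := by
  refine .of_span_eq_top (TensorProduct.span_tmul_eq_top K A R) ?_
  rintro _ ⟨a, r, rfl⟩ _ ⟨b, s, rfl⟩ _ ⟨c, t, rfl⟩ _ ⟨d, p, rfl⟩ _ ⟨e, q, rfl⟩
  simp only [tensorProduct_tmul, mul_assoc, ← TensorProduct.add_tmul]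
  rw [hμ, TensorProduct.zero_tmul]

/-- Values at sequences of pure tensors with one first factor `x` record the word of the second
factors, from left to right. -/
theorem eval_tensorProduct (t : TernaryTree) (x : A) (r : ℕ → R) :
    TernaryTree.eval (tensorProduct μ R) t (fun j => x ⊗ₜ r j)
      = TernaryTree.eval μ t (fun _ => x) ⊗ₜ[K] ((List.range t.degree).map r).prod := by
  induction t generalizing r with
  | of _ => simp [TernaryTree.eval, TernaryMonomial.degree]
  | mul a b c ha hb hc =>
    rw [TernaryTree.eval, ha, hb, hc, tensorProduct_tmul, TernaryTree.eval,
      TernaryMonomial.degree, List.range_add, List.range_add]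
    simp [Function.comp_def, mul_assoc]

end TensorProduct

/-! ### The components of the free algebra -/

namespace FreePartiallyAssociative

open TernaryPolynomial TernaryTree

open scoped TensorProduct

variable (K : Type u) [Field K] {V : Type v} [AddCommGroup V] [Module K V]

/-- A monomial in the letters `V` is a tree together with the sequence of its letters. -/
theorem exists_mkQ_monomial_eq_eval (t : TernaryMonomial V) :
    ∃ (s : TernaryTree) (y : ℕ → V), s.degree = t.degree ∧
      (relations K V).mkQ (monomial K t) = eval (product K V) s fun j => ι K V (y j) := by
  induction t with
  | of v => exact ⟨.of (), fun _ => v, rfl, rfl⟩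
  | mul a b c ha hb hc =>
    obtain ⟨a', y, ha, hy⟩ := ha
    obtain ⟨b', z, hb, hz⟩ := hb
    obtain ⟨c', w, hc, hw⟩ := hc
    refine ⟨.mul a' b' c', glue a'.degree b'.degree y z w, ?_, ?_⟩
    · rw [TernaryMonomial.degree, TernaryMonomial.degree, ha, hb, hc]
    · rw [eval_mul_glue, ← hy, ← hz, ← hw, product_mk, PartiallyAssociativeOperad.mul_monomial]

theorem eval_mem_component (t : TernaryTree) (y : ℕ → V) :
    eval (product K V) t (fun j => ι K V (y j)) ∈ component K V t.degree := by
  have h : ∃ s : TernaryMonomial V, s.degree = t.degree ∧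
      eval (product K V) t (fun j => ι K V (y j)) = (relations K V).mkQ (monomial K s) := by
    induction t generalizing y with
    | of _ => exact ⟨.of (y 0), rfl, rfl⟩
    | mul a b c ha hb hc =>
      obtain ⟨a', ha, ha'⟩ := ha y
      obtain ⟨b', hb, hb'⟩ := hb fun j => y (a.degree + j)
      obtain ⟨c', hc, hc'⟩ := hc fun j => y (a.degree + b.degree + j)
      refine ⟨.mul a' b' c', ?_, ?_⟩
      · rw [TernaryMonomial.degree, TernaryMonomial.degree, ha, hb, hc]
      · rw [eval, ha', hb', hc', product_mk, PartiallyAssociativeOperad.mul_monomial]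
  obtain ⟨s, hs, h⟩ := h
  rw [h]
  exact Submodule.mem_map_of_mem (Submodule.subset_span ⟨s, hs, rfl⟩)

variable {K} {n : ℕ} (b : Module.Basis (Fin n) K V)

/-- The normal form number `i` with `2 p + 1` leaves, evaluated at a word of length `2 p + 1` in
the elements of a basis of `V`. The word is continued periodically to a sequence. -/
def normalWord (p : ℕ) (z : Fin (normalCount p) × (Fin (2 * p + 1) → Fin n)) :
    FreePartiallyAssociative K V :=
  eval (product K V) (normalTree p z.1) fun j => ι K V (b (z.2 (Fin.ofNat (2 * p + 1) j)))

theorem component_eq_span [CharZero K] (p : ℕ) :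
    component K V (2 * p + 1) = Submodule.span K (Set.range (normalWord b p)) := by
  refine le_antisymm ?_ (Submodule.span_le.2 ?_)
  · rw [component, homogeneous, Submodule.map_span, ← Set.image_comp, Submodule.span_le]
    rintro _ ⟨t, ht, rfl⟩
    obtain ⟨s, y, hs, hy⟩ := exists_mkQ_monomial_eq_eval K t
    change t.degree = 2 * p + 1 at ht
    rw [Function.comp_apply, hy]
    have hs' : (PartiallyAssociativeOperad.operadicIdeal K).mkQ (monomial K s) ∈
        PartiallyAssociativeOperad.component K (2 * p + 1) :=
      Submodule.mem_map_of_mem (Submodule.subset_span ⟨s, hs.trans ht, rfl⟩)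
    rw [PartiallyAssociativeOperad.component_eq_span, Submodule.mem_span_range_iff_exists_fun]
      at hs'
    obtain ⟨k, hk⟩ := hs'
    -- The reduction to normal forms in the operad holds for all values of the letters.
    have hmem : ∑ i, k i • monomial K (normalTree p i) - monomial K s ∈
        PartiallyAssociativeOperad.operadicIdeal K := by
      rw [← Submodule.Quotient.mk_eq_zero, ← Submodule.mkQ_apply, map_sub, map_sum, ← hk]
      simp
    have h := PartiallyAssociativeOperad.evalPoly_eq_zero (product_isPartiallyAssociative K V)
      hmem (2 * p + 1) fun j => ι K V (y j)
    simp only [map_sub, map_sum, map_smul, evalPoly_monomial, hs, ht, if_true, sub_eq_zero] at h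
    rw [← h]
    refine Submodule.sum_mem _ fun i _ => Submodule.smul_mem _ _ ?_
    rw [if_pos (degree_normalTree i.2)]
    have hb : ∀ j, ι K V (y j) ∈ Submodule.span K (Set.range fun l => ι K V (b l)) := fun j => by
      have : y j ∈ Submodule.span K (Set.range b) := b.span_eq ▸ Submodule.mem_top
      have := Submodule.mem_map_of_mem (f := ι K V) this
      rwa [Submodule.map_span, ← Set.range_comp] at this
    refine Submodule.span_mono ?_ (eval_mem_span_eval (product K V) (fun l => ι K V (b l)) _ _ hb)
    rintro _ ⟨w, rfl⟩
    refine ⟨(i, fun j => w j), eval_congr _ _ fun j hj => ?_⟩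
    rw [degree_normalTree i.2] at hj
    simp [Nat.mod_eq_of_lt hj]
  · rintro _ ⟨⟨i, w⟩, rfl⟩
    have h := eval_mem_component K (normalTree p i) fun j => b (w (Fin.ofNat (2 * p + 1) j))
    rwa [degree_normalTree i.2] at h

/-- If the values of the normal forms at an element of some partially associative algebra are
linearly independent, then so are the normal forms evaluated at words: the letters can be told
apart after tensoring with a free associative algebra. -/
theorem linearIndependent_normalWord_of {A : Type w} [AddCommGroup A] [Module K A]
    {μ : A →ₗ[K] A →ₗ[K] A →ₗ[K] A} (hμ : IsPartiallyAssociative μ) (x : A) {p : ℕ}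
    (hx : LinearIndependent K fun i : Fin (normalCount p) =>
      eval μ (normalTree p i) fun _ => x) : LinearIndependent K (normalWord b p) := by
  let X : Fin n → MonoidAlgebra K (FreeMonoid (Fin n)) := fun l =>
    MonoidAlgebra.of K _ (FreeMonoid.of l)
  obtain ⟨F, ⟨hF, hFι⟩, -⟩ := existsUnique_lift
    (tensorProduct μ (MonoidAlgebra K (FreeMonoid (Fin n))))
    (tensorProduct_isPartiallyAssociative _ hμ) (b.constr K fun l => x ⊗ₜ[K] X l)
  refine LinearIndependent.of_comp F ?_
  let word : (Fin (2 * p + 1) → Fin n) → FreeMonoid (Fin n) := fun w =>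
    ((List.range (2 * p + 1)).map fun j => FreeMonoid.of (w (Fin.ofNat (2 * p + 1) j))).prod
  have hword : Function.Injective word := by
    intro w w' h
    have hl : ∀ (f : ℕ → Fin n) (l : List ℕ),
        (l.map fun j => FreeMonoid.of (f j)).prod.toList = l.map f := by
      intro f l
      induction l with
      | nil => rfl
      | cons j l ih =>
        rw [List.map_cons, List.prod_cons, FreeMonoid.toList_mul, ih, FreeMonoid.toList_of,
          List.singleton_append, List.map_cons]
    have h' := congrArg FreeMonoid.toList h
    rw [hl, hl, List.map_inj_left] at h'
    ext1 j
    simpa using h' j (List.mem_range.2 j.2)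
  have h := hx.tmul_of_isDomain
    ((MonoidAlgebra.basis (FreeMonoid (Fin n)) K).linearIndependent.comp word hword)
  have key : ∀ z, F (normalWord b p z) = eval μ (normalTree p z.1) (fun _ => x) ⊗ₜ[K]
      MonoidAlgebra.basis (FreeMonoid (Fin n)) K (word z.2) := by
    intro z
    have h₁ : ∀ j, F (ι K V (b (z.2 (Fin.ofNat (2 * p + 1) j))))
        = x ⊗ₜ[K] X (z.2 (Fin.ofNat (2 * p + 1) j)) := fun j => by
      rw [hFι, Module.Basis.constr_basis]
    rw [normalWord, eval_map _ _ F hF]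
    simp only [h₁]
    rw [eval_tensorProduct _ (normalTree p z.1) x
      fun j => X (z.2 (Fin.ofNat (2 * p + 1) j)), degree_normalTree z.1.2]
    congr 1
    rw [MonoidAlgebra.basis_apply, ← MonoidAlgebra.of_apply, map_list_prod, List.map_map]
    rfl
  rw [show F ∘ normalWord b p = _ from funext key]
  exact h

theorem linearIndependent_normalWord (p : ℕ) : LinearIndependent K (normalWord b p) :=
  linearIndependent_normalWord_of b (Model.product_isPartiallyAssociative K) (Model.gen K)
    (Model.linearIndependent_eval K p)

include b in
theorem rank_component [CharZero K] (p : ℕ) :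
    Module.rank K (component K V (2 * p + 1))
      = ((normalCount p * n ^ (2 * p + 1) : ℕ) : Cardinal) := by
  have h := linearIndependent_normalWord b p
  have hr := rank_span h
  rw [component_eq_span b, hr]
  have := Cardinal.mk_range_eq_of_injective h.injective
  rw [Cardinal.mk_fintype (_ × _), Cardinal.lift_natCast] at this
  simpa using this

end FreePartiallyAssociative

end

theorem mainTheorem3 (K : Type*) [Field K] [CharZero K]
    (V : Type*) [AddCommGroup V] [Module K V] [FiniteDimensional K V]
    (n : ℕ) (hn : Module.finrank K V = n) :
    (Module.rank K (FreePartiallyAssociative.component K V 1) = (n : Cardinal) ∧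
      Module.rank K (FreePartiallyAssociative.component K V 3) = ((n ^ 3 : ℕ) : Cardinal) ∧
      Module.rank K (FreePartiallyAssociative.component K V 5) = ((2 * n ^ 5 : ℕ) : Cardinal) ∧
      ∀ p : ℕ, 3 ≤ p →
        Module.rank K (FreePartiallyAssociative.component K V (2 * p + 1)) =
          (((p + 1) * n ^ (2 * p + 1) : ℕ) : Cardinal)) ∧
    (Module.rank K (PartiallyAssociativeOperad.component K 1) = (1 : Cardinal) ∧
      Module.rank K (PartiallyAssociativeOperad.component K 3) = (1 : Cardinal) ∧
      Module.rank K (PartiallyAssociativeOperad.component K 5) = (2 : Cardinal) ∧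
      ∀ p : ℕ, 3 ≤ p →
        Module.rank K (PartiallyAssociativeOperad.component K (2 * p + 1)) =
          ((p + 1 : ℕ) : Cardinal)) := by
  have hV := FreePartiallyAssociative.rank_component (Module.finBasisOfFinrankEq K V hn)
  have hO := PartiallyAssociativeOperad.rank_component K
  have h₀ : TernaryTree.normalCount 0 = 1 := rfl
  have h₁ : TernaryTree.normalCount 1 = 1 := rfl
  have h₂ : TernaryTree.normalCount 2 = 2 := rfl
  have h₃ : ∀ p, 3 ≤ p → TernaryTree.normalCount p = p + 1 := by
    rintro (_ | _ | _ | p) hp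
    all_goals first | omega | rfl
  refine ⟨⟨?_, ?_, ?_, fun p hp => ?_⟩, ?_, ?_, ?_, fun p hp => ?_⟩
  · simpa [h₀] using hV 0
  · simpa [h₁] using hV 1
  · simpa [h₂] using hV 2
  · rw [hV p, h₃ p hp]
  · simpa [h₀] using hO 0
  · simpa [h₁] using hO 1
  · simpa [h₂] using hO 2
  · rw [hO p, h₃ p hp]
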